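/- Let $S$ be a closed, connected, oriented hyperbolic surface, written as $S=\mathbb{H}^2/\Gamma$, where $\Gamma\cong\pi_1(S)$ acts on the universal cover $\widetilde S=\mathbb{H}^2$ freely, properly discontinuously and cocompactly by orientation preserving isometries, and let $\omega_h$ be its hyperbolic area form. Let $\rho:\pi_1(S)\to \mathrm{PSL}_2(\mathbb{C})$ be a representation, where $\mathrm{PSL}_2(\mathbb{C})$ acts on hyperbolic space $\mathbb{H}^3$ by orientation preserving isometries and on its ideal boundary $\partial\mathbb{H}^3=\mathbb{CP}^1$ by projective transformations. For a smooth $\rho$-equivariant map $\tilde f:\widetilde S\to\mathbb{H}^3$ (that is, $\tilde f(\gamma p)=\rho(\gamma)\tilde f(p)$ for all $\gamma\in\pi_1(S)$ and $p\in\widetilde S$) let $$F(\tilde f)=\int_S \|d\tilde f\|_1\,\omega_h ,\qquad \|d\tilde f_p\|_1=\mathrm{tr}\sqrt{(d\tilde f_p)^{T}\, d\tilde f_p}\,,$$ where the function $\|d\tilde f\|_1$, being $\pi_1(S)$-invariant, is regarded as a function on $S$. Call such an $\tilde f$ *critical* if, for every smooth family $(\tilde f_t)_{t\in(-\epsilon,\epsilon)}$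 of $\rho$-equivariant maps with $\tilde f_0=\tilde f$, $$\liminf_{t\to 0,\ t\neq 0}\ \frac{F(\tilde f_t)-F(\tilde f)}{|t|}\ \geq\ 0 .$$ When $t\mapsto F(\tilde f_t)$ is differentiable at $0$, as it is if $\tilde f$ is an immersion, this condition says that $\frac{d}{dt}F(\tilde f_t)\big|_{t=0}=0$. In particular, every $\tilde f$ for which this derivative exists and vanishes for all such families is critical, and so is every minimizer of $F$ among smooth $\rho$-equivariant maps. (i) If there exists a critical smooth $\rho$-equivariant map $\tilde f$, then $\rho$ is reductive, i.e. the (Zariski) closure of the image of $\rho$ is a reductive subgroup of $\mathrm{PSL}_2(\mathbb{C})$. (ii) If there exists a critical smooth $\rho$-equivariant map $\tilde f$ whose differential has rank $2$ at some point, then $\rho$ is non-elementary, i.e. the image of $\rho$ fixes no point of $\mathbb{H}^3\cup\partial\mathbb{H}^3$. -/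

import Mathlib

open scoped UpperHalfPlane MatrixGroups ComplexOrder ContDiff Topology Matrix
open MeasureTheory

noncomputable section

namespace SchattenEnergy

/-! ## Hyperbolic 3-space -/

/-- Hyperbolic 3-space `ℍ³`, as the space of positive definite Hermitian `2 × 2` matrices of
determinant one. Inside the Minkowski space of all Hermitian matrices with the quadratic form
`-det`, of signature `(3, 1)`, this is the upper sheet of the hyperboloid `-det = -1`. -/
def H3 : Type := {X : Matrix (Fin 2) (Fin 2) ℂ // X.PosDef ∧ X.det = 1}

/-- The bilinear form on Hermitian `2 × 2` matrices whose quadratic form is `-det`. Its restriction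
to the tangent spaces of `H3` is the hyperbolic metric (of curvature `-1`). -/
def minkowski (Y Z : Matrix (Fin 2) (Fin 2) ℂ) : ℝ :=
  ((Y * Z).trace - Y.trace * Z.trace).re / 2

theorem minkowski_comm (Y Z : Matrix (Fin 2) (Fin 2) ℂ) : minkowski Y Z = minkowski Z Y := by
  simp only [minkowski, Matrix.trace_mul_comm Y Z, mul_comm Y.trace]

theorem minkowski_self (Y : Matrix (Fin 2) (Fin 2) ℂ) : minkowski Y Y = (-Y.det).re := by
  have : (Y * Y).trace - Y.trace * Y.trace = (2 : ℝ) * (-Y.det) := by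
    simp only [Matrix.trace_fin_two, Matrix.det_fin_two, Matrix.mul_apply, Fin.sum_univ_two]
    push_cast
    ring
  rw [minkowski, this, Complex.re_ofReal_mul]
  ring

/-- `SL(2, ℂ)` acts on `ℍ³` by `A • X = A X Aᴴ`. -/
instance : MulAction SL(2, ℂ) H3 where
  smul A X := ⟨A.1 * X.1 * A.1ᴴ, by
    constructor
    · refine X.2.1.mul_mul_conjTranspose_same ?_
      apply Matrix.vecMul_injective_of_isUnit
      rw [Matrix.isUnit_iff_isUnit_det, A.2]
      exact isUnit_one
    · simp [Matrix.det_mul, X.2.2, Matrix.det_conjTranspose, A.2]⟩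
  one_smul X := Subtype.ext (by
    change (1 : Matrix (Fin 2) (Fin 2) ℂ) * X.1 * (1 : Matrix (Fin 2) (Fin 2) ℂ)ᴴ = X.1
    simp)
  mul_smul A B X := Subtype.ext (by
    change (A.1 * B.1) * X.1 * (A.1 * B.1)ᴴ = A.1 * (B.1 * X.1 * B.1ᴴ) * A.1ᴴ
    simp only [Matrix.conjTranspose_mul, Matrix.mul_assoc])

theorem coe_smul (A : SL(2, ℂ)) (X : H3) : (A • X).1 = A.1 * X.1 * A.1ᴴ := rfl

theorem center_le_ker :
    Subgroup.center SL(2, ℂ) ≤ (MulAction.toPermHom SL(2, ℂ) H3).ker := by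
  intro A hA
  obtain ⟨r, hr, hrA⟩ := Matrix.SpecialLinearGroup.mem_center_iff.1 hA
  rw [MonoidHom.mem_ker]
  ext1 X
  refine Subtype.ext ?_
  change A.1 * X.1 * A.1ᴴ = X.1
  have h1 : r * star r = 1 := by
    have hr' : r = 1 ∨ r = -1 := by simpa using hr
    rcases hr' with rfl | rfl <;> simp
  have hA' : A.1 = r • (1 : Matrix (Fin 2) (Fin 2) ℂ) := by
    rw [← hrA, Matrix.scalar_apply, Matrix.smul_one_eq_diagonal]
  rw [hA']
  rw [Matrix.conjTranspose_smul, Matrix.conjTranspose_one, Matrix.smul_mul, Matrix.one_mul,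
    Matrix.mul_smul, Matrix.mul_one, smul_smul, mul_comm, h1, one_smul]

/-- The induced action of `PSL(2, ℂ)` on `ℍ³`, by orientation preserving isometries. -/
instance : MulAction PSL(2, ℂ) H3 :=
  MulAction.compHom H3
    (QuotientGroup.lift (Subgroup.center SL(2, ℂ)) (MulAction.toPermHom SL(2, ℂ) H3) center_le_ker)

theorem mk_smul (A : SL(2, ℂ)) (X : H3) : (A : PSL(2, ℂ)) • X = A • X := rfl

/-- The ideal boundary `∂ℍ³ = ℂP¹`: the line spanned by `v` is the endpoint in which the null ray
of `v vᴴ` ends. `PSL(2, ℂ)` acts on it by projective transformations. -/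
abbrev IdealBoundary : Type := Projectivization ℂ (Fin 2 → ℂ)

/-! ## Closed hyperbolic surfaces -/

/-- `Γ` acts on the hyperbolic plane `ℍ` as the deck group of a closed oriented hyperbolic surface
`S = ℍ / Γ`: by orientation preserving isometries, freely, properly discontinuously and
cocompactly. The action identifies `ℍ` with the universal cover of `S`, and `Γ` with `π₁(S)`. -/
structure IsClosedSurfaceGroup (Γ : Type*) [Group Γ] [MulAction Γ ℍ] : Prop where
  isometric : ∀ γ : Γ, ∃ g : SL(2, ℝ), ∀ z : ℍ, γ • z = g • z
  free : ∀ (γ : Γ) (z : ℍ), γ • z = z → γ = 1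
  properlyDiscontinuous : ∀ K : Set ℍ, IsCompact K →
    {γ : Γ | (((fun z : ℍ => γ • z) '' K) ∩ K).Nonempty}.Finite
  cocompact : ∃ K : Set ℍ, IsCompact K ∧ ∀ z : ℍ, ∃ γ : Γ, γ • z ∈ K

/-! ## Smooth equivariant maps, their differential and their energy -/

/-- Smoothness of a map `ℍ → ℍ³`; `ℍ` is an open subset of `ℂ` and `ℍ³` is a submanifold of the
space of matrices. -/
def IsSmooth (f : ℍ → H3) : Prop :=
  ∀ i j, ContDiffOn ℝ ∞ (fun w : ℂ => (f (UpperHalfPlane.ofComplex w)).1 i j) {w | 0 < w.im}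

/-- Smoothness of a family `φ t`, `t ∈ (-ε, ε)`, of maps `ℍ → ℍ³`, jointly in `t` and the point. -/
def IsSmoothFamily (ε : ℝ) (φ : ℝ → ℍ → H3) : Prop :=
  ∀ i j, ContDiffOn ℝ ∞ (fun q : ℂ × ℝ => (φ q.2 (UpperHalfPlane.ofComplex q.1)).1 i j)
    ({w | 0 < w.im} ×ˢ Set.Ioo (-ε) ε)

variable {Γ : Type*} [Group Γ] [MulAction Γ ℍ]

/-- `f (γ z) = ρ(γ) (f z)`. -/
def IsEquivariant (ρ : Γ →* PSL(2, ℂ)) (f : ℍ → H3) : Prop :=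
  ∀ (γ : Γ) (z : ℍ), f (γ • z) = ρ γ • f z

/-- The differential `df_p` of `f : ℍ → ℍ³`, as a real linear map from `T_p ℍ = ℂ` to the space of
matrices (in which the tangent space of `ℍ³` at `f p` is contained). -/
def differential (f : ℍ → H3) (p : ℍ) : ℂ →ₗ[ℝ] Matrix (Fin 2) (Fin 2) ℂ where
  toFun v := Matrix.of fun i j =>
    fderiv ℝ (fun w : ℂ => (f (UpperHalfPlane.ofComplex w)).1 i j) (p : ℂ) v
  map_add' v w := by ext i j; simp
  map_smul' c v := by
    ext i j
    simp only [map_smul, Matrix.of_apply, Matrix.smul_apply, RingHom.id_apply]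

/-- The orthonormal basis `y ∂x, y ∂y` of `T_p ℍ` for the hyperbolic metric `(dx² + dy²) / y²`. -/
def frame (p : ℍ) : Fin 2 → ℂ := ![(p.im : ℂ), (p.im : ℂ) * Complex.I]

/-- The matrix of `(df_p)ᵀ ∘ df_p` in the orthonormal basis `frame p`; equivalently, the Gram matrix
of the pulled back metric. -/
def gram (f : ℍ → H3) (p : ℍ) : Matrix (Fin 2) (Fin 2) ℝ :=
  Matrix.of fun i j => minkowski (differential f p (frame p i)) (differential f p (frame p j))

theorem gram_isHermitian (f : ℍ → H3) (p : ℍ) : (gram f p).IsHermitian := by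
  ext i j
  simp [gram, minkowski_comm]

/-- The 1-Schatten norm `‖df_p‖₁ = tr √((df_p)ᵀ ∘ df_p)`, that is, the sum of the square roots of the
eigenvalues of `(df_p)ᵀ ∘ df_p`. -/
def schattenNorm (f : ℍ → H3) (p : ℍ) : ℝ :=
  ∑ i, √((gram_isHermitian f p).eigenvalues i)

/-- The 1-Schatten energy `F(f) = ∫_S ‖df‖₁ ω_h`, as an integral over a fundamental domain `D` of the
deck group, with respect to the hyperbolic area `dx dy / y²` (which is `volume` on `ℍ`). -/
def energy (D : Set ℍ) (f : ℍ → H3) : ℝ := ∫ p in D, schattenNorm f p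

/-! ## Critical points -/

/-- `φ` is an isomonodromic deformation `(φ t)`, `t ∈ (-ε, ε)`, of `f`: a smooth family of
`ρ`-equivariant maps with `φ 0 = f`. -/
structure IsIsomonodromicDeformation (ρ : Γ →* PSL(2, ℂ)) (f : ℍ → H3) (ε : ℝ)
    (φ : ℝ → ℍ → H3) : Prop where
  pos : 0 < ε
  smooth : IsSmoothFamily ε φ
  equivariant : ∀ t ∈ Set.Ioo (-ε) ε, IsEquivariant ρ (φ t)
  initial : φ 0 = f

/-- `f` is critical for `F` among smooth `ρ`-equivariant maps: along an isomonodromic deformation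
`F` has no decrease of first order, that is, `F(φ t) ≥ F(f) - o(|t|)` as `t → 0`. Where
`t ↦ F(φ t)` is differentiable at `0` (as it is when `f` is an immersion), this says that the
derivative vanishes, see `criticalAlong_iff`; the formulation also covers maps `f` at which `F` is not
differentiable. -/
def IsCritical (D : Set ℍ) (ρ : Γ →* PSL(2, ℂ)) (f : ℍ → H3) : Prop :=
  ∀ (ε : ℝ) (φ : ℝ → ℍ → H3), IsIsomonodromicDeformation ρ f ε φ →
    ∀ c > 0, ∀ᶠ t in 𝓝 (0 : ℝ), energy D f - c * |t| ≤ energy D (φ t)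

/-- For a function that is differentiable at `0`, the condition in `IsCritical` means that the
derivative is zero. -/
theorem criticalAlong_iff {u : ℝ → ℝ} {a : ℝ} (hu : HasDerivAt u a 0) :
    (∀ c > 0, ∀ᶠ t in 𝓝 (0 : ℝ), u 0 - c * |t| ≤ u t) ↔ a = 0 := by
  have key : ∀ c > 0, ∀ᶠ t in 𝓝 (0 : ℝ), |u t - u 0 - t * a| ≤ c * |t| := by
    intro c hc
    have := (hasDerivAt_iff_isLittleO.1 hu).def hc
    simpa using this
  constructor
  · intro h
    by_contra ha
    have hpos : 0 < |a| := abs_pos.2 ha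
    obtain ⟨δ, hδ, H⟩ := Metric.eventually_nhds_iff.1
      ((h (|a| / 4) (by positivity)).and (key (|a| / 4) (by positivity)))
    have h1 : ∀ t : ℝ, |t| < δ → -(t * a) ≤ |a| / 2 * |t| := fun t ht => by
      obtain ⟨e1, e2⟩ := H (y := t) (by simpa using ht)
      have := (abs_le.1 e2).2
      nlinarith
    have hd : |δ / 2| = δ / 2 := abs_of_pos (by positivity)
    have p1 := h1 (δ / 2) (by rw [hd]; linarith)
    have p2 := h1 (-(δ / 2)) (by rw [abs_neg, hd]; linarith)
    rw [abs_neg] at p2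
    rw [hd] at p1 p2
    rcases abs_cases a with ⟨e, _⟩ | ⟨e, _⟩ <;> rw [e] at p1 p2 hpos <;> nlinarith
  · rintro rfl c hc
    filter_upwards [key c hc] with t ht
    have := (abs_le.1 ht).1
    linarith

/-! ## Reductive and non-elementary representations -/

/-- A subset of `PSL(2, ℂ)` is Zariski closed if its preimage in `SL(2, ℂ)` is the set of common
zeros of a set of polynomials in the matrix entries. -/
def IsZariskiClosed (Z : Set PSL(2, ℂ)) : Prop :=
  ∃ I : Set (MvPolynomial (Fin 2 × Fin 2) ℂ), ∀ A : SL(2, ℂ),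
    (A : PSL(2, ℂ)) ∈ Z ↔ ∀ P ∈ I, MvPolynomial.eval (fun ij => A.1 ij.1 ij.2) P = 0

/-- The Zariski closure of a subgroup (the Zariski closure of a subgroup is itself a subgroup). -/
def zariskiClosure (H : Subgroup PSL(2, ℂ)) : Subgroup PSL(2, ℂ) :=
  sInf {G | H ≤ G ∧ IsZariskiClosed (G : Set PSL(2, ℂ))}

/-- An element of `PSL(2, ℂ)` is unipotent if it is represented by a unipotent matrix. -/
def IsUnipotent (g : PSL(2, ℂ)) : Prop :=
  ∃ A : SL(2, ℂ), (A : PSL(2, ℂ)) = g ∧ IsNilpotent (A.1 - 1)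

/-- An algebraic subgroup of `PSL(2, ℂ)` is reductive if its unipotent radical is trivial, i.e. if it
has no normal unipotent subgroup but the trivial one. (The Zariski closure of a normal unipotent
subgroup is again normal and unipotent, and it is connected as the characteristic is zero.) -/
def IsReductiveSubgroup (G : Subgroup PSL(2, ℂ)) : Prop :=
  ∀ N : Subgroup PSL(2, ℂ), N ≤ G → (∀ g ∈ G, ∀ n ∈ N, g * n * g⁻¹ ∈ N) →
    (∀ n ∈ N, IsUnipotent n) → N = ⊥

/-- A representation is reductive if the closure of its image is a reductive group. -/
def IsReductive (ρ : Γ →* PSL(2, ℂ)) : Prop := IsReductiveSubgroup (zariskiClosure ρ.range)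

/-- A representation is non-elementary if it has no fixed point in `ℍ³ ∪ ∂ℍ³`. -/
def IsNonElementary (ρ : Γ →* PSL(2, ℂ)) : Prop :=
  (¬ ∃ x : H3, ∀ γ : Γ, ρ γ • x = x) ∧ (¬ ∃ ξ : IdealBoundary, ∀ γ : Γ, ρ γ • ξ = ξ)

end SchattenEnergy

end

/-!
The theorem rests on a comparison of Schatten norms. For a Gram matrix `G` of size two,
`‖df‖₁² = tr G + 2 √(det G)`. So if `g` pulls back the metric of `ℍ³` to a smaller one than `f` does,
then `‖df‖₁² - ‖dg‖₁²` is at least the difference of the traces of the Gram matrices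
(`IsSmooth.schattenNorm_sq_add_le`). Hence a critical map cannot be deformed equivariantly, for `t > 0`,
such that the pulled back metrics decrease and their traces drop by at least `t * e` with an invariant
continuous `e ≥ 0`, unless `e = 0`: the energy would drop by `t ∫ e / (2 ‖df‖₁)`
(`IsCritical.rate_eq_zero`). No differentiability of the energy is needed for this. Cocompactness makes
the integrals finite.

There are two such deformations. If `ρ` fixes a point `x` of `ℍ³`, the contraction towards `x` commutes
with the stabilizer of `x` and shortens all tangent vectors; so `df = 0`
(`IsCritical.differential_eq_zero`). If `ρ` fixes an ideal point `ξ`, the geodesic flow towards `ξ`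
commutes with the stabilizer of `ξ`. In the upper half-space with `ξ = ∞` it shortens the horizontal part
`dz` and preserves the vertical part `dh` of the metric `(|dz|² + dh²) / h²`; so `dz = 0` along a critical
map, whose image therefore lies in a geodesic ending in `ξ`. Then `df` has rank at most one, and `ρ`
fixes the other end of the geodesic, too (`IsCritical.exists_fixed_and_finrank_le`). This proves (ii).

For (i), a representation that is not reductive fixes an ideal point, the fixed point of the unipotent
radical of the Zariski closure of its image (`exists_fixed_of_not_isReductive`). By the above it fixes a
second one. But the stabilizer of a pair of ideal points is a Zariski closed group without unipotent
elements other than the identity, so `ρ` is reductive (`isReductive_of_fixed_pair`).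
-/

namespace SchattenEnergy

/-! ### The Minkowski space of Hermitian matrices -/

theorem minkowski_eq_re_im {Y Z : Matrix (Fin 2) (Fin 2) ℂ} (hY : Y.IsHermitian)
    (hZ : Z.IsHermitian) :
    minkowski Y Z = (Y 0 1).re * (Z 0 1).re + (Y 0 1).im * (Z 0 1).im
      - ((Y 0 0).re * (Z 1 1).re + (Y 1 1).re * (Z 0 0).re) / 2 := by
  have hy : Y 1 0 = star (Y 0 1) := (hY.apply 1 0).symm
  have hz : Z 1 0 = star (Z 0 1) := (hZ.apply 1 0).symm
  have y0 : (Y 0 0).im = 0 := Complex.conj_eq_iff_im.1 (hY.apply 0 0)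
  have y1 : (Y 1 1).im = 0 := Complex.conj_eq_iff_im.1 (hY.apply 1 1)
  simp only [minkowski, Matrix.trace_fin_two, Matrix.mul_apply, Fin.sum_univ_two, hy, hz]
  simp [y0, y1]
  ring

theorem minkowski_add_left (Y Y' Z : Matrix (Fin 2) (Fin 2) ℂ) :
    minkowski (Y + Y') Z = minkowski Y Z + minkowski Y' Z := by
  simp only [minkowski, add_mul, Matrix.trace_add, ← add_div, ← Complex.add_re]
  congr 2
  ring

theorem minkowski_smul_left (c : ℝ) (Y Z : Matrix (Fin 2) (Fin 2) ℂ) :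
    minkowski (c • Y) Z = c * minkowski Y Z := by
  simp only [minkowski, Matrix.trace_smul, smul_mul_assoc,
    ← smul_sub, Complex.smul_re, smul_eq_mul, mul_div_assoc]

theorem minkowski_add_right (Y Z Z' : Matrix (Fin 2) (Fin 2) ℂ) :
    minkowski Y (Z + Z') = minkowski Y Z + minkowski Y Z' := by
  rw [minkowski_comm, minkowski_add_left, minkowski_comm Z, minkowski_comm Z']

theorem minkowski_smul_right (c : ℝ) (Y Z : Matrix (Fin 2) (Fin 2) ℂ) :
    minkowski Y (c • Z) = c * minkowski Y Z := by
  rw [minkowski_comm, minkowski_smul_left, minkowski_comm Z]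

/-- The action of `SL(2, ℂ)` on matrices preserves the Minkowski form. By polarization,
this is the multiplicativity of the determinant. -/
theorem minkowski_conj (A : SL(2, ℂ)) (Y Z : Matrix (Fin 2) (Fin 2) ℂ) :
    minkowski (A.1 * Y * A.1ᴴ) (A.1 * Z * A.1ᴴ) = minkowski Y Z := by
  have key : ∀ W : Matrix (Fin 2) (Fin 2) ℂ,
      minkowski (A.1 * W * A.1ᴴ) (A.1 * W * A.1ᴴ) = minkowski W W := by
    intro W
    simp [minkowski_self, Matrix.det_mul, Matrix.det_conjTranspose, A.2]
  have h := key (Y + Z)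
  simp only [mul_add, add_mul, minkowski_add_left, minkowski_add_right, key] at h
  rw [minkowski_comm (A.1 * Z * A.1ᴴ), minkowski_comm Z Y] at h
  linarith

namespace H3

theorem isHermitian (X : H3) : X.1.IsHermitian := X.2.1.1

theorem re_pos (X : H3) (i : Fin 2) : 0 < (X.1 i i).re :=
  (Complex.pos_iff.1 (X.2.1.diag_pos (i := i))).1

theorem ofReal_re (X : H3) (i : Fin 2) : ((X.1 i i).re : ℂ) = X.1 i i :=
  X.isHermitian.coe_re_apply_self i

theorem minkowski_self (X : H3) : minkowski X.1 X.1 = -1 := by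
  rw [SchattenEnergy.minkowski_self, X.2.2]
  simp

/-- The equation `det X = 1` in real coordinates. -/
theorem re_mul_re (X : H3) :
    (X.1 0 0).re * (X.1 1 1).re = 1 + (X.1 0 1).re ^ 2 + (X.1 0 1).im ^ 2 := by
  have h := X.minkowski_self
  rw [minkowski_eq_re_im X.isHermitian X.isHermitian] at h
  linarith

/-- A unit timelike Hermitian matrix with a positive diagonal entry lies on the upper sheet of the
hyperboloid. -/
theorem posDef_and_det_of_minkowski {X : Matrix (Fin 2) (Fin 2) ℂ} (hX : X.IsHermitian)
    (h1 : minkowski X X = -1) (hpos : 0 < (X 1 1).re) : X.PosDef ∧ X.det = 1 := by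
  have hx : X 1 0 = star (X 0 1) := (hX.apply 1 0).symm
  have x0 : ((X 0 0).re : ℂ) = X 0 0 := hX.coe_re_apply_self 0
  have x1 : ((X 1 1).re : ℂ) = X 1 1 := hX.coe_re_apply_self 1
  rw [minkowski_eq_re_im hX hX] at h1
  set a := (X 0 0).re
  set d := (X 1 1).re
  set b := X 0 1 with hb
  have had : a * d = 1 + b.re ^ 2 + b.im ^ 2 := by linarith
  constructor
  · refine Matrix.PosDef.of_dotProduct_mulVec_pos hX fun v hv => ?_
    -- completing the square: `d * vᴴ X v = |d v₁ + b̄ v₀|² + |v₀|²`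
    have hval : star v ⬝ᵥ X *ᵥ v = ((a * (v 0).normSq + d * (v 1).normSq
        + 2 * (b * v 1 * star (v 0)).re : ℝ) : ℂ) := by
      simp only [dotProduct, Matrix.mulVec, Fin.sum_univ_two, hx, ← x0, ← x1, ← hb]
      apply Complex.ext <;> simp [Complex.normSq_apply, a, d] <;> ring
    rw [hval, Complex.zero_lt_real]
    have hid : d * (a * (v 0).normSq + d * (v 1).normSq + 2 * (b * v 1 * star (v 0)).re)
        = Complex.normSq (d * v 1 + star b * v 0) + (v 0).normSq := by
      simp [Complex.normSq_apply]
      linear_combination ((v 0).re ^ 2 + (v 0).im ^ 2) * had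
    refine pos_of_mul_pos_right (a := d) ?_ hpos.le
    rw [hid]
    by_cases hv0 : v 0 = 0
    · have hv1 : v 1 ≠ 0 := fun h => hv (by ext i; fin_cases i <;> simp [hv0, h])
      have : (d : ℂ) * v 1 + star b * v 0 ≠ 0 := by
        simp [hv0, hv1, hpos.ne']
      exact add_pos_of_pos_of_nonneg (Complex.normSq_pos.2 this) (Complex.normSq_nonneg _)
    · exact add_pos_of_nonneg_of_pos (Complex.normSq_nonneg _) (Complex.normSq_pos.2 hv0)
  · rw [Matrix.det_fin_two, hx, ← x0, ← x1, ← hb]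
    apply Complex.ext <;> simp [a, d]
    · change a * d - (b.re * b.re + b.im * b.im) = 1
      linarith
    · ring

/-- The reversed Cauchy–Schwarz inequality on the hyperboloid: `-⟨X, x⟩ = cosh (dist X x) ≥ 1`. -/
theorem one_le_neg_minkowski (X x : H3) : 1 ≤ -minkowski X.1 x.1 := by
  rw [minkowski_eq_re_im X.isHermitian x.isHermitian]
  have h1 := X.re_mul_re
  have h2 := x.re_mul_re
  have p1 := X.re_pos 1
  have p2 := x.re_pos 1
  generalize (X.1 0 0).re = a, (X.1 1 1).re = d, (X.1 0 1).re = b, (X.1 0 1).im = c,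
    (x.1 0 0).re = a', (x.1 1 1).re = d', (x.1 0 1).re = b', (x.1 0 1).im = c' at *
  have hdd : 0 < d * d' := mul_pos p1 p2
  have hid : 2 * (d * d') * (-(b * b' + c * c' - (a * d' + d * a') / 2) - 1)
      = (d - d') ^ 2 + (b * d' - b' * d) ^ 2 + (c * d' - c' * d) ^ 2 := by
    linear_combination d' ^ 2 * h1 + d ^ 2 * h2
  by_contra hlt
  push Not at hlt
  have := mul_neg_of_pos_of_neg (mul_pos two_pos hdd) (sub_neg.2 hlt)
  nlinarith [sq_nonneg (d - d'), sq_nonneg (b * d' - b' * d), sq_nonneg (c * d' - c' * d)]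

/-- A unit timelike Hermitian matrix lies on the upper sheet of the hyperboloid if its product with
some point of the upper sheet is negative. -/
theorem posDef_and_det_of_minkowski_neg {X : Matrix (Fin 2) (Fin 2) ℂ} (hX : X.IsHermitian)
    (h1 : minkowski X X = -1) (x : H3) (hx : minkowski X x.1 < 0) : X.PosDef ∧ X.det = 1 := by
  refine posDef_and_det_of_minkowski hX h1 (not_le.1 fun hle => ?_)
  have hne : (X 1 1).re ≠ 0 := by
    intro h0
    rw [minkowski_eq_re_im hX hX, h0] at h1
    nlinarith [sq_nonneg (X 0 1).re, sq_nonneg (X 0 1).im]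
  -- otherwise `-X` lies on the upper sheet, and `⟨-X, x⟩` is negative as well
  have h := posDef_and_det_of_minkowski (X := (-1 : ℝ) • X) (by
      simpa using hX.neg) (by
      rw [minkowski_smul_left, minkowski_smul_right, h1]; norm_num) (by
      simpa using lt_of_le_of_ne hle hne)
  have := one_le_neg_minkowski ⟨_, h⟩ x
  simp only [minkowski_smul_left] at this
  linarith

end H3

/-- `Y` is a tangent vector of `H3` at `X`. -/
structure IsTangent (X : H3) (Y : Matrix (Fin 2) (Fin 2) ℂ) : Prop where
  isHermitian : Y.IsHermitian
  orthogonal : minkowski X.1 Y = 0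

namespace IsTangent

variable {X : H3} {Y : Matrix (Fin 2) (Fin 2) ℂ}

/-- The hyperbolic metric in the coordinates `z = X₀₁ / X₁₁`, `h = 1 / X₁₁` of the upper half-space:
`⟨Y, Y⟩ = (|dz|² + dh²) / h²`. -/
theorem minkowski_self_mul (hY : IsTangent X Y) :
    minkowski Y Y * (X.1 1 1).re ^ 2 =
      Complex.normSq (Y 0 1 * X.1 1 1 - X.1 0 1 * Y 1 1) + (Y 1 1).re ^ 2 := by
  have h0 := hY.orthogonal
  rw [minkowski_eq_re_im X.isHermitian hY.isHermitian] at h0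
  have h1 := X.re_mul_re
  rw [minkowski_eq_re_im hY.isHermitian hY.isHermitian, ← X.ofReal_re 1,
    ← hY.isHermitian.coe_re_apply_self 1]
  simp only [Complex.normSq_apply, Complex.sub_re, Complex.sub_im, Complex.mul_re, Complex.mul_im,
    Complex.ofReal_re, Complex.ofReal_im, RCLike.re_eq_complex_re, Complex.coe_algebraMap]
  linear_combination (2 * (Y 1 1).re * (X.1 1 1).re) * h0 + (Y 1 1).re ^ 2 * h1

theorem minkowski_self_nonneg (hY : IsTangent X Y) : 0 ≤ minkowski Y Y := by
  have h := hY.minkowski_self_mul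
  have hpos := pow_pos (X.re_pos 1) 2
  refine nonneg_of_mul_nonneg_left (b := (X.1 1 1).re ^ 2) ?_ hpos
  rw [h]
  exact add_nonneg (Complex.normSq_nonneg _) (sq_nonneg _)

/-- A tangent vector is determined by its components `dz` and `dh`. -/
theorem eq_zero_of_normSq_eq_zero (hY : IsTangent X Y)
    (h1 : Complex.normSq (Y 0 1 * X.1 1 1 - X.1 0 1 * Y 1 1) = 0) (h2 : (Y 1 1).re = 0) :
    Y = 0 := by
  have hX : X.1 1 1 ≠ 0 := fun h => by simpa [h] using X.re_pos 1
  have e11 : Y 1 1 = 0 := by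
    rw [← hY.isHermitian.coe_re_apply_self 1]
    simpa using h2
  have e01 : Y 0 1 = 0 := by
    rw [Complex.normSq_eq_zero, e11] at h1
    simpa [hX] using h1
  have e10 : Y 1 0 = 0 := by rw [← hY.isHermitian.apply 1 0, e01, star_zero]
  have e00 : Y 0 0 = 0 := by
    have h0 := hY.orthogonal
    rw [minkowski_eq_re_im X.isHermitian hY.isHermitian, e01, e11] at h0
    rw [← hY.isHermitian.coe_re_apply_self 0]
    simpa [(X.re_pos 1).ne'] using h0
  ext i j
  fin_cases i <;> fin_cases j <;> assumption

theorem eq_zero (hY : IsTangent X Y) (h : minkowski Y Y = 0) : Y = 0 := by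
  have h' := hY.minkowski_self_mul
  rw [h, zero_mul] at h'
  have n1 := Complex.normSq_nonneg (Y 0 1 * X.1 1 1 - X.1 0 1 * Y 1 1)
  have n2 := sq_nonneg (Y 1 1).re
  exact hY.eq_zero_of_normSq_eq_zero (by linarith) (by
    have : (Y 1 1).re ^ 2 = 0 := by linarith
    simpa using this)

/-- A tangent vector changes `cosh (dist X x) = -⟨X, x⟩` by at most `sinh (dist X x)` times its
length. -/
theorem sq_minkowski_le (hY : IsTangent X Y) (x : H3) :
    minkowski Y x.1 ^ 2 ≤ (minkowski X.1 x.1 ^ 2 - 1) * minkowski Y Y := by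
  -- Cauchy–Schwarz in the tangent space at `X`, for `Y` and the projection `W` of `x`
  set c := minkowski X.1 x.1 with hc
  set m := minkowski Y x.1 with hm
  have hXX := X.minkowski_self
  have hxx := x.minkowski_self
  have hXY := hY.orthogonal
  have hYX : minkowski Y X.1 = 0 := by rw [minkowski_comm]; exact hXY
  have hxX : minkowski x.1 X.1 = c := minkowski_comm _ _
  have hxY : minkowski x.1 Y = m := minkowski_comm _ _
  have quad : ∀ r : ℝ, 0 ≤ minkowski Y Y * (r * r) + 2 * m * r + (c ^ 2 - 1) := by
    intro r
    have hW : IsTangent X (r • Y + (x.1 + c • X.1)) := by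
      refine ⟨((hY.isHermitian.smul (IsSelfAdjoint.all r)).add (x.isHermitian.add
        (X.isHermitian.smul (IsSelfAdjoint.all c)))), ?_⟩
      simp only [minkowski_add_right, minkowski_smul_right, hXY, hXX, ← hc]
      ring
    have h := hW.minkowski_self_nonneg
    simp only [minkowski_add_right, minkowski_smul_right, minkowski_add_left, minkowski_smul_left,
      hXY, hXX, hYX, hxX, hxY, hxx, ← hc, ← hm] at h
    linarith
  have hd := discrim_le_zero quad
  rw [discrim] at hd
  linarith

end IsTangent

/-! ### The differential of a smooth map -/

theorem isOpen_im_pos : IsOpen {w : ℂ | 0 < w.im} := isOpen_lt continuous_const Complex.continuous_im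

theorem hasDerivAt_minkowski {X Z : ℝ → Matrix (Fin 2) (Fin 2) ℂ}
    {X' Z' : Matrix (Fin 2) (Fin 2) ℂ} {s : ℝ}
    (hX : ∀ i j, HasDerivAt (fun t => X t i j) (X' i j) s)
    (hZ : ∀ i j, HasDerivAt (fun t => Z t i j) (Z' i j) s) :
    HasDerivAt (fun t => minkowski (X t) (Z t)) (minkowski X' (Z s) + minkowski (X s) Z') s := by
  have key := (((((hX 0 0).mul (hZ 0 0)).add ((hX 0 1).mul (hZ 1 0))).add
    (((hX 1 0).mul (hZ 0 1)).add ((hX 1 1).mul (hZ 1 1)))).sub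
    (((hX 0 0).add (hX 1 1)).mul ((hZ 0 0).add (hZ 1 1))))
  have key' := (Complex.reCLM.hasFDerivAt.comp_hasDerivAt s key).div_const 2
  refine (key'.congr_deriv ?_).congr_of_eventuallyEq (Filter.Eventually.of_forall fun t => ?_)
  · simp only [minkowski, Matrix.trace_fin_two, Matrix.mul_apply, Fin.sum_univ_two,
      Complex.reCLM_apply, ← add_div, ← Complex.add_re, Pi.add_apply]
    congr 2
    ring
  · simp [minkowski, Matrix.trace_fin_two, Matrix.mul_apply, Fin.sum_univ_two]

theorem contDiffOn_minkowski {E : Type*} [NormedAddCommGroup E] [NormedSpace ℝ E] {s : Set E}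
    {X : E → Matrix (Fin 2) (Fin 2) ℂ} (hX : ∀ i j, ContDiffOn ℝ ∞ (fun q => X q i j) s)
    (Z : Matrix (Fin 2) (Fin 2) ℂ) : ContDiffOn ℝ ∞ (fun q => minkowski (X q) Z) s := by
  simp only [minkowski, Matrix.trace_fin_two, Matrix.mul_apply, Fin.sum_univ_two]
  have h := (((((hX 0 0).mul (contDiffOn_const (c := Z 0 0))).add
    ((hX 0 1).mul (contDiffOn_const (c := Z 1 0)))).add
    (((hX 1 0).mul (contDiffOn_const (c := Z 0 1))).add
      ((hX 1 1).mul (contDiffOn_const (c := Z 1 1))))).sub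
    (((hX 0 0).add (hX 1 1)).mul (contDiffOn_const (c := Z 0 0 + Z 1 1))))
  exact (Complex.reCLM.contDiff.comp_contDiffOn h).div_const 2

theorem continuous_minkowski {E : Type*} [TopologicalSpace E]
    {X Z : E → Matrix (Fin 2) (Fin 2) ℂ} (hX : ∀ i j, Continuous fun q => X q i j)
    (hZ : ∀ i j, Continuous fun q => Z q i j) : Continuous fun q => minkowski (X q) (Z q) := by
  simp only [minkowski, Matrix.trace_fin_two, Matrix.mul_apply, Fin.sum_univ_two]
  fun_prop

theorem contDiffOn_smul {E : Type*} [NormedAddCommGroup E] [NormedSpace ℝ E] {s : Set E}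
    {X : E → H3} (hX : ∀ i j, ContDiffOn ℝ ∞ (fun q => (X q).1 i j) s) (A : SL(2, ℂ))
    (i j : Fin 2) : ContDiffOn ℝ ∞ (fun q => (A • X q).1 i j) s := by
  simp only [coe_smul, Matrix.mul_apply, Fin.sum_univ_two]
  have h := fun k l => (((contDiffOn_const (c := A.1 i 0)).mul (hX 0 k)).add
    ((contDiffOn_const (c := A.1 i 1)).mul (hX 1 k))).mul (contDiffOn_const (c := A.1ᴴ k l))
  exact (h 0 j).add (h 1 j)

namespace IsSmooth

variable {f : ℍ → H3}

theorem differentiableAt (hf : IsSmooth f) (p : ℍ) (i j : Fin 2) :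
    DifferentiableAt ℝ (fun w : ℂ => (f (UpperHalfPlane.ofComplex w)).1 i j) (p : ℂ) :=
  ((hf i j).contDiffAt (isOpen_im_pos.mem_nhds p.im_pos)).differentiableAt (by simp)

/-- The chain rule along a curve. -/
theorem hasDerivAt_comp (hf : IsSmooth f) {c : ℝ → ℂ} {v : ℂ} {p : ℍ} (hc : HasDerivAt c v 0)
    (h0 : c 0 = p) (i j : Fin 2) :
    HasDerivAt (fun s => (f (UpperHalfPlane.ofComplex (c s))).1 i j) (differential f p v i j) 0 := by
  have h := (hf.differentiableAt p i j).hasFDerivAt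
  rw [← h0] at h
  have := h.comp_hasDerivAt 0 hc
  rw [h0] at this
  exact this

theorem hasDerivAt_line (hf : IsSmooth f) (p : ℍ) (v : ℂ) (i j : Fin 2) :
    HasDerivAt (fun s : ℝ => (f (UpperHalfPlane.ofComplex (p + s * v))).1 i j)
      (differential f p v i j) 0 := by
  refine hf.hasDerivAt_comp (c := fun s : ℝ => (p : ℂ) + s * v) ?_ (by simp) i j
  simpa using ((Complex.ofRealCLM.hasDerivAt (x := (0 : ℝ))).mul_const v).const_add (p : ℂ)

/-- A way to compute the differential, entry by entry, along lines. -/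
theorem differential_apply_eq (hf : IsSmooth f) {p : ℍ} {v : ℂ} {i j : Fin 2} {y : ℂ}
    (h : HasDerivAt (fun s : ℝ => (f (UpperHalfPlane.ofComplex (p + s * v))).1 i j) y 0) :
    differential f p v i j = y :=
  (hf.hasDerivAt_line p v i j).unique h

theorem isTangent (hf : IsSmooth f) (p : ℍ) (v : ℂ) : IsTangent (f p) (differential f p v) := by
  constructor
  · ext i j
    refine (hf.differential_apply_eq ?_).symm
    refine (hf.hasDerivAt_line p v j i).star.congr_of_eventuallyEq
      (Filter.Eventually.of_forall fun s => ?_)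
    exact (H3.isHermitian _).apply _ _ |>.symm
  · have h := hasDerivAt_minkowski (hf.hasDerivAt_line p v) (hf.hasDerivAt_line p v)
    simp only [H3.minkowski_self, Complex.ofReal_zero, zero_mul, add_zero,
      UpperHalfPlane.ofComplex_apply] at h
    have := h.unique (hasDerivAt_const (0 : ℝ) (-1 : ℝ))
    rw [minkowski_comm] at this
    linarith

theorem differential_smul (hf : IsSmooth f) {g : ℍ → H3} (hg : IsSmooth g) (A : SL(2, ℂ))
    (hgf : ∀ z, g z = A • f z) (p : ℍ) (v : ℂ) :
    differential g p v = A.1 * differential f p v * A.1ᴴ := by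
  ext i j
  refine hg.differential_apply_eq ?_
  have h := fun k l => hf.hasDerivAt_line p v k l
  simp only [hgf, coe_smul, Matrix.mul_apply, Fin.sum_univ_two]
  have := fun k l => (((h 0 k).const_mul (A.1 i 0)).add ((h 1 k).const_mul (A.1 i 1))).mul_const
    (A.1ᴴ k l)
  exact (this 0 j).add (this 1 j)

theorem smul (hf : IsSmooth f) (A : SL(2, ℂ)) : IsSmooth fun z => A • f z :=
  contDiffOn_smul hf A

theorem continuous_apply (hf : IsSmooth f) (i j : Fin 2) : Continuous fun p => (f p).1 i j := by
  have h : Continuous fun p : ℍ => (f (UpperHalfPlane.ofComplex (p : ℂ))).1 i j :=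
    (hf i j).continuousOn.comp_continuous UpperHalfPlane.continuous_coe fun p => p.im_pos
  simpa using h

theorem continuous_differential (hf : IsSmooth f) (k i j : Fin 2) :
    Continuous fun p => differential f p (frame p k) i j := by
  have h : Continuous fun p : ℍ =>
      fderiv ℝ (fun w : ℂ => (f (UpperHalfPlane.ofComplex w)).1 i j) (p : ℂ) :=
    ((hf i j).continuousOn_fderiv_of_isOpen isOpen_im_pos (by simp)).comp_continuous
      UpperHalfPlane.continuous_coe fun p => p.im_pos
  refine h.clm_apply ?_
  have := UpperHalfPlane.continuous_im
  fin_cases k <;> simp only [frame] <;> simp <;> fun_prop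

end IsSmooth

/-! ### The Gram matrix and the Schatten norm -/

/-- Every tangent vector of `ℍ` is a combination of the orthonormal frame. -/
theorem exists_frame (p : ℍ) (v : ℂ) : ∃ a b : ℝ, v = a • frame p 0 + b • frame p 1 := by
  refine ⟨v.re / p.im, v.im / p.im, ?_⟩
  have := p.im_ne_zero
  apply Complex.ext <;> simp [frame] <;> field_simp

/-- The quadratic form `v ↦ ⟨df v, df v⟩` on the tangent space of `ℍ` at `p`, that is, the pullback of
the hyperbolic metric of `ℍ³` by `f`. -/
noncomputable def pullback (f : ℍ → H3) (p : ℍ) (v : ℂ) : ℝ :=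
  minkowski (differential f p v) (differential f p v)

theorem trace_gram (f : ℍ → H3) (p : ℍ) :
    (gram f p).trace = pullback f p (frame p 0) + pullback f p (frame p 1) :=
  Matrix.trace_fin_two _

theorem IsSmooth.pullback_nonneg {f : ℍ → H3} (hf : IsSmooth f) (p : ℍ) (v : ℂ) :
    0 ≤ pullback f p v :=
  (hf.isTangent p v).minkowski_self_nonneg

theorem pullback_frame (f : ℍ → H3) (p : ℍ) (a b : ℝ) :
    pullback f p (a • frame p 0 + b • frame p 1) =
      gram f p 0 0 * a ^ 2 + 2 * gram f p 0 1 * (a * b) + gram f p 1 1 * b ^ 2 := by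
  simp only [pullback, map_add, map_smul, minkowski_add_left, minkowski_add_right,
    minkowski_smul_left, minkowski_smul_right, gram, Matrix.of_apply]
  rw [minkowski_comm (differential f p (frame p 1)) (differential f p (frame p 0))]
  ring

/-- Monotonicity of the determinant on positive semidefinite forms of two variables. -/
theorem det_le_of_forms_le {a b d a' b' d' : ℝ}
    (h : ∀ x y : ℝ, 0 ≤ a * x ^ 2 + 2 * b * (x * y) + d * y ^ 2)
    (h' : ∀ x y : ℝ, a * x ^ 2 + 2 * b * (x * y) + d * y ^ 2 ≤
      a' * x ^ 2 + 2 * b' * (x * y) + d' * y ^ 2) :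
    a * d - b ^ 2 ≤ a' * d' - b' ^ 2 := by
  have key : ∀ {a b d : ℝ}, (∀ x y : ℝ, 0 ≤ a * x ^ 2 + 2 * b * (x * y) + d * y ^ 2) →
      0 ≤ a ∧ 0 ≤ d ∧ b ^ 2 ≤ a * d := by
    intro a b d h
    have ha : 0 ≤ a := by simpa using h 1 0
    have hd : 0 ≤ d := by simpa using h 0 1
    refine ⟨ha, hd, ?_⟩
    have h2 := discrim_le_zero (a := a) (b := 2 * b) (c := d) fun x => by
      have := h x 1
      linarith
    rw [discrim] at h2
    linarith
  obtain ⟨ha, hd, hb⟩ := key h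
  obtain ⟨pa, pd, pb⟩ := key (a := a' - a) (b := b' - b) (d := d' - d) fun x y => by
    have := h' x y
    linarith
  -- the mixed discriminant of two positive semidefinite forms is nonnegative
  have mix : 2 * (b * (b' - b)) ≤ a * (d' - d) + d * (a' - a) := by
    refine le_of_abs_le (abs_le_of_sq_le_sq ?_ (by positivity))
    have : b ^ 2 * (b' - b) ^ 2 ≤ (a * d) * ((a' - a) * (d' - d)) :=
      mul_le_mul hb pb (sq_nonneg _) (mul_nonneg ha hd)
    nlinarith [sq_nonneg (a * (d' - d) - d * (a' - a))]
  nlinarith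

namespace IsSmooth

variable {f g : ℍ → H3}

theorem gram_posSemidef (hf : IsSmooth f) (p : ℍ) : (gram f p).PosSemidef := by
  refine Matrix.PosSemidef.of_dotProduct_mulVec_nonneg (gram_isHermitian f p) fun x => ?_
  have h := hf.pullback_nonneg p (x 0 • frame p 0 + x 1 • frame p 1)
  rw [pullback_frame] at h
  have h10 : gram f p 1 0 = gram f p 0 1 := (gram_isHermitian f p).apply 0 1
  simp only [dotProduct, Matrix.mulVec, Fin.sum_univ_two, star_trivial, Pi.star_apply, h10]
  linarith

theorem schattenNorm_sq (hf : IsSmooth f) (p : ℍ) :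
    schattenNorm f p ^ 2 = (gram f p).trace + 2 * √(gram f p).det := by
  have hh := gram_isHermitian f p
  have h := (hf.gram_posSemidef p).eigenvalues_nonneg
  have ht : (gram f p).trace = _ := hh.trace_eq_sum_eigenvalues
  have hd : (gram f p).det = _ := hh.det_eq_prod_eigenvalues
  rw [ht, hd, schattenNorm]
  simp only [Fin.sum_univ_two, Fin.prod_univ_two, RCLike.ofReal_real_eq_id, id]
  rw [Real.sqrt_mul (h 0), add_sq, Real.sq_sqrt (h 0), Real.sq_sqrt (h 1)]
  ring

theorem schattenNorm_eq (hf : IsSmooth f) (p : ℍ) :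
    schattenNorm f p = √((gram f p).trace + 2 * √(gram f p).det) := by
  rw [← hf.schattenNorm_sq, Real.sqrt_sq]
  exact Finset.sum_nonneg fun i _ => Real.sqrt_nonneg _

/-- If `dg` is pointwise shorter than `df`, then the squares of the Schatten norms differ at least as
much as the squares of the Hilbert–Schmidt norms. -/
theorem schattenNorm_sq_add_le (hf : IsSmooth f) (hg : IsSmooth g) (p : ℍ)
    (h : ∀ v, pullback g p v ≤ pullback f p v) :
    schattenNorm g p ^ 2 + ((gram f p).trace - (gram g p).trace) ≤ schattenNorm f p ^ 2 := by
  have hdet : (gram g p).det ≤ (gram f p).det := by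
    have h10 : ∀ f, gram f p 1 0 = gram f p 0 1 := fun f => (gram_isHermitian f p).apply 0 1
    rw [Matrix.det_fin_two, Matrix.det_fin_two, h10, h10, ← sq, ← sq]
    refine det_le_of_forms_le (fun x y => ?_) (fun x y => ?_)
    · rw [← pullback_frame]
      exact hg.pullback_nonneg p _
    · rw [← pullback_frame, ← pullback_frame]
      exact h _
  rw [hf.schattenNorm_sq, hg.schattenNorm_sq]
  have := Real.sqrt_le_sqrt hdet
  linarith

theorem continuous_gram (hf : IsSmooth f) (i j : Fin 2) : Continuous fun p => gram f p i j :=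
  continuous_minkowski (hf.continuous_differential i) (hf.continuous_differential j)

theorem continuous_trace_gram (hf : IsSmooth f) : Continuous fun p => (gram f p).trace := by
  simp only [Matrix.trace_fin_two]
  exact (hf.continuous_gram 0 0).add (hf.continuous_gram 1 1)

theorem continuous_schattenNorm (hf : IsSmooth f) : Continuous (schattenNorm f) := by
  rw [funext hf.schattenNorm_eq]
  have := hf.continuous_gram
  simp only [Matrix.trace_fin_two, Matrix.det_fin_two]
  fun_prop

end IsSmooth

theorem schattenNorm_nonneg (f : ℍ → H3) (p : ℍ) : 0 ≤ schattenNorm f p :=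
  Finset.sum_nonneg fun _ _ => Real.sqrt_nonneg _

/-- The Gram matrix at `g • p`, for an isometry `g` of `ℍ` that is intertwined by `f` with an isometry
of `ℍ³`, is conjugate to the one at `p` by a rotation, as `g` maps frames to rotated frames. -/
theorem IsSmooth.gram_smul {f : ℍ → H3} (hf : IsSmooth f) (g : SL(2, ℝ)) (A : SL(2, ℂ))
    (hA : ∀ z : ℍ, f (g • z) = A • f z) (p : ℍ) :
    (gram f (g • p)).trace = (gram f p).trace ∧ (gram f (g • p)).det = (gram f p).det := by
  set γ : GL (Fin 2) ℝ := (g : GL (Fin 2) ℝ) with hγ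
  have hdet : γ.val.det = 1 := by simp [hγ]
  have hsmul : ∀ z : ℍ, g • z = γ • z := fun z => rfl
  set d : ℂ := UpperHalfPlane.denom γ p with hd
  have hd0 : d ≠ 0 := UpperHalfPlane.denom_ne_zero γ p
  have hn0 : Complex.normSq d ≠ 0 := by simpa using hd0
  have him : (g • p).im = p.im / Complex.normSq d := by
    rw [hsmul, UpperHalfPlane.im_smul_eq_div_normSq]
    have : γ.det.val = 1 := hdet
    simp [this, hd]
  -- the chain rule for `f ∘ g = A • f`
  have chain : ∀ v, differential f (g • p) (v / d ^ 2) = A.1 * differential f p v * A.1ᴴ := by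
    intro v
    have h1 : HasDerivAt (fun s : ℝ => ((γ • UpperHalfPlane.ofComplex (p + s * v) : ℍ) : ℂ))
        (v / d ^ 2) 0 := by
      have ha := (UpperHalfPlane.hasStrictDerivAt_smul (g := γ) (by rw [hdet]; norm_num) p).hasDerivAt
      have hb : HasDerivAt (fun s : ℝ => (p : ℂ) + s * v) v 0 := by
        simpa using ((Complex.ofRealCLM.hasDerivAt (x := (0 : ℝ))).mul_const v).const_add (p : ℂ)
      have hb0 : (p : ℂ) = (p : ℂ) + ((0 : ℝ) : ℂ) * v := by simp
      rw [hb0] at ha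
      have := ha.scomp (0 : ℝ) hb
      refine this.congr_deriv ?_
      rw [← hb0, hdet, smul_eq_mul, Complex.ofReal_one, ← hd]
      ring
    have hs : IsSmooth fun z => A • f z := hf.smul A
    rw [← hf.differential_smul hs A (fun _ => rfl) p v]
    ext i j
    refine (hs.differential_apply_eq ?_).symm
    have h2 := hf.hasDerivAt_comp (p := g • p) h1 (by simp [hsmul]) i j
    refine h2.congr_of_eventuallyEq (Filter.Eventually.of_forall fun s => ?_)
    simp only [UpperHalfPlane.ofComplex_apply, ← hA, hsmul]
  set u : ℂ := d ^ 2 / Complex.normSq d with hu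
  have hu1 : u.re ^ 2 + u.im ^ 2 = 1 := by
    have : Complex.normSq u = 1 := by
      rw [hu, Complex.normSq_div, map_pow, Complex.normSq_ofReal, ← sq, div_self (pow_ne_zero 2 hn0)]
    rw [← this, Complex.normSq_apply]
    ring
  have hn0' : (Complex.normSq d : ℂ) ≠ 0 := by exact_mod_cast hn0
  have f0 : frame (g • p) 0 = (u.re • frame p 0 + u.im • frame p 1) / d ^ 2 := by
    have : u.re • frame p 0 + u.im • frame p 1 = u * p.im := by
      simp only [frame, Matrix.cons_val_zero, Matrix.cons_val_one, Complex.real_smul]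
      linear_combination (p.im : ℂ) * Complex.re_add_im u
    rw [this, hu]
    simp only [frame, him, Matrix.cons_val_zero]
    push_cast
    field_simp
  have f1 : frame (g • p) 1 = ((-u.im) • frame p 0 + u.re • frame p 1) / d ^ 2 := by
    have : (-u.im) • frame p 0 + u.re • frame p 1 = u * (p.im * Complex.I) := by
      simp only [frame, Matrix.cons_val_zero, Matrix.cons_val_one, Complex.real_smul]
      push_cast
      linear_combination (p.im * Complex.I : ℂ) * Complex.re_add_im u
        - (u.im * p.im : ℂ) * Complex.I_sq
    rw [this, hu]
    simp only [frame, him, Matrix.cons_val_one, Matrix.cons_val_zero]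
    push_cast
    field_simp
  have h10 : ∀ q, gram f q 1 0 = gram f q 0 1 := fun q => (gram_isHermitian f q).apply 0 1
  have entry : ∀ i j, gram f (g • p) i j = minkowski (differential f (g • p) (frame (g • p) i))
    (differential f (g • p) (frame (g • p) j)) := fun _ _ => rfl
  have entry' : ∀ i j, minkowski (differential f p (frame p i)) (differential f p (frame p j)) =
    gram f p i j := fun _ _ => rfl
  have e00 := entry 0 0
  have e01 := entry 0 1
  have e11 := entry 1 1
  rw [f0, chain, minkowski_conj] at e00
  rw [f0, f1, chain, chain, minkowski_conj] at e01
  rw [f1, chain, minkowski_conj] at e11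
  simp only [map_add, map_smul, minkowski_add_left, minkowski_add_right, minkowski_smul_left,
    minkowski_smul_right, entry', h10] at e00 e01 e11
  rw [Matrix.trace_fin_two, Matrix.trace_fin_two, Matrix.det_fin_two, Matrix.det_fin_two, h10, h10,
    e00, e01, e11]
  constructor
  · linear_combination (gram f p 0 0 + gram f p 1 1) * hu1
  · linear_combination (gram f p 0 0 * gram f p 1 1 - gram f p 0 1 ^ 2) *
      (u.re ^ 2 + u.im ^ 2 + 1) * hu1

/-! ### Closed surface groups and their fundamental domains -/

namespace IsClosedSurfaceGroup

variable {Γ : Type*} [Group Γ] [MulAction Γ ℍ]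

theorem countable (hΓ : IsClosedSurfaceGroup Γ) : Countable Γ := by
  let K := compactCovering ℍ
  rw [← Set.countable_univ_iff]
  refine (Set.countable_iUnion fun n : ℕ =>
    (hΓ.properlyDiscontinuous (K n) (isCompact_compactCovering ℍ n)).countable).mono fun γ _ => ?_
  obtain ⟨m, hm⟩ := exists_mem_compactCovering UpperHalfPlane.I
  obtain ⟨n, hn⟩ := exists_mem_compactCovering (γ • UpperHalfPlane.I)
  exact Set.mem_iUnion.2 ⟨max m n, γ • UpperHalfPlane.I,
    ⟨_, compactCovering_subset ℍ (le_max_left m n) hm, rfl⟩,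
    compactCovering_subset ℍ (le_max_right m n) hn⟩

theorem continuousConstSMul (hΓ : IsClosedSurfaceGroup Γ) : ContinuousConstSMul Γ ℍ where
  continuous_const_smul γ := by
    obtain ⟨g, hg⟩ := hΓ.isometric γ
    rw [funext hg]
    exact continuous_const_smul (g : GL (Fin 2) ℝ)

theorem measurableConstSMul (hΓ : IsClosedSurfaceGroup Γ) : MeasurableConstSMul Γ ℍ where
  measurable_const_smul γ := (hΓ.continuousConstSMul.continuous_const_smul γ).measurable

theorem smulInvariantMeasure (hΓ : IsClosedSurfaceGroup Γ) :
    SMulInvariantMeasure Γ ℍ (volume : Measure ℍ) where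
  measure_preimage_smul γ s hs := by
    obtain ⟨g, hg⟩ := hΓ.isometric γ
    rw [funext hg]
    exact SMulInvariantMeasure.measure_preimage_smul (g : GL (Fin 2) ℝ) hs

open scoped Pointwise in
theorem volume_lt_top (hΓ : IsClosedSurfaceGroup Γ) {D : Set ℍ}
    (hD : IsFundamentalDomain Γ D (volume : Measure ℍ)) : volume D < ⊤ := by
  have := hΓ.countable
  have := hΓ.measurableConstSMul
  have := hΓ.smulInvariantMeasure
  obtain ⟨K, hK, hcov⟩ := hΓ.cocompact
  calc volume D ≤ volume (⋃ γ : Γ, γ • K ∩ D) := by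
        refine measure_mono fun z hz => ?_
        obtain ⟨γ, hγ⟩ := hcov z
        exact Set.mem_iUnion.2 ⟨γ⁻¹, ⟨γ • z, hγ, inv_smul_smul γ z⟩, hz⟩
    _ ≤ ∑' γ : Γ, volume (γ • K ∩ D) := measure_iUnion_le _
    _ = volume K := (hD.measure_eq_tsum K).symm
    _ < ⊤ := hK.measure_lt_top

/-- A continuous invariant function is bounded, and therefore integrable over a fundamental
domain. -/
theorem integrableOn (hΓ : IsClosedSurfaceGroup Γ) {D : Set ℍ}
    (hD : IsFundamentalDomain Γ D (volume : Measure ℍ)) {u : ℍ → ℝ} (hu : Continuous u)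
    (hinv : ∀ (γ : Γ) (z : ℍ), u (γ • z) = u z) : IntegrableOn u D := by
  obtain ⟨K, hK, hcov⟩ := hΓ.cocompact
  obtain ⟨C, hC⟩ := hK.exists_bound_of_continuousOn hu.continuousOn
  refine Measure.integrableOn_of_bounded (M := C) (hΓ.volume_lt_top hD).ne
    hu.aestronglyMeasurable (Filter.Eventually.of_forall fun z => ?_)
  obtain ⟨γ, hγ⟩ := hcov z
  rw [← hinv γ z]
  exact hC _ hγ

open scoped Pointwise in
/-- A nonnegative invariant function whose integral over a fundamental domain vanishes is zero almost
everywhere on `ℍ`. -/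
theorem ae_eq_zero_of_setIntegral_eq_zero (hΓ : IsClosedSurfaceGroup Γ) {D : Set ℍ}
    (hD : IsFundamentalDomain Γ D (volume : Measure ℍ)) {u : ℍ → ℝ} (hu : IntegrableOn u D)
    (hm : Measurable u) (h0 : ∀ z, 0 ≤ u z) (hinv : ∀ (γ : Γ) (z : ℍ), u (γ • z) = u z)
    (hint : ∫ z in D, u z = 0) : ∀ᵐ z : ℍ, u z = 0 := by
  have := hΓ.countable
  have := hΓ.measurableConstSMul
  have := hΓ.smulInvariantMeasure
  have h := (setIntegral_eq_zero_iff_of_nonneg_ae (Filter.Eventually.of_forall h0) hu).1 hint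
  refine hD.measure_zero_of_invariant {z | u z = 0}ᶜ (fun γ => ?_) ?_
  · ext z
    rw [Set.mem_smul_set_iff_inv_smul_mem]
    simp [hinv]
  · have hmeas : MeasurableSet {z | u z = 0}ᶜ := (hm (measurableSet_singleton 0)).compl
    rw [← Measure.restrict_apply hmeas]
    exact h

variable {ρ : Γ →* PSL(2, ℂ)} {f : ℍ → H3}

theorem gram_smul (hΓ : IsClosedSurfaceGroup Γ) (hf : IsSmooth f) (he : IsEquivariant ρ f) (γ : Γ)
    (z : ℍ) : (gram f (γ • z)).trace = (gram f z).trace ∧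
      (gram f (γ • z)).det = (gram f z).det := by
  obtain ⟨g, hg⟩ := hΓ.isometric γ
  obtain ⟨A, hA⟩ := QuotientGroup.mk_surjective (ρ γ)
  rw [hg]
  refine hf.gram_smul g A (fun w => ?_) z
  rw [← hg, he, ← hA]
  rfl

theorem schattenNorm_smul (hΓ : IsClosedSurfaceGroup Γ) (hf : IsSmooth f) (he : IsEquivariant ρ f)
    (γ : Γ) (z : ℍ) : schattenNorm f (γ • z) = schattenNorm f z := by
  obtain ⟨h1, h2⟩ := hΓ.gram_smul hf he γ z
  rw [hf.schattenNorm_eq, hf.schattenNorm_eq, h1, h2]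

end IsClosedSurfaceGroup

instance : (volume : Measure ℍ).IsOpenPosMeasure where
  open_pos U hU hne h0 := by
    have hac : volume.comap UpperHalfPlane.coe ≪ (volume : Measure ℍ) := by
      rw [UpperHalfPlane.volume_def]
      have hc : Continuous fun z : ℍ => (1 / NNReal.mk z.im z.im_pos.le) ^ 2 := by
        refine .pow (.div₀ continuous_const ?_ ?_) _
        · exact UpperHalfPlane.continuous_im.subtype_mk _
        · exact fun z => NNReal.ne_iff.mp z.im_ne_zero
      refine withDensity_absolutelyContinuous' ?_ (Filter.Eventually.of_forall fun z => ?_)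
      · exact (ENNReal.continuous_coe.comp hc).measurable.aemeasurable
      · rw [ENNReal.coe_ne_zero]
        exact pow_ne_zero 2 (one_div_ne_zero (NNReal.ne_iff.mp z.im_ne_zero))
    have h1 := hac h0
    rw [UpperHalfPlane.measurableEmbedding_coe.comap_apply] at h1
    exact (UpperHalfPlane.isOpenEmbedding_coe.isOpenMap U hU).measure_ne_zero volume
      (hne.image _) h1

/-! ### Deformations that decrease the energy to first order -/

theorem IsSmoothFamily.isSmooth {ε : ℝ} {φ : ℝ → ℍ → H3} (h : IsSmoothFamily ε φ) {t : ℝ}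
    (ht : t ∈ Set.Ioo (-ε) ε) : IsSmooth (φ t) := by
  intro i j
  have h1 : ContDiffOn ℝ ∞ (fun w : ℂ => (w, t)) {w | 0 < w.im} := by fun_prop
  exact (h i j).comp h1 fun w hw => ⟨hw, ht⟩

/-- The first variation argument. If a deformation `φ` of a critical map `f` shortens `df` pointwise,
and decreases the square of its Hilbert–Schmidt norm at the rate `e ≥ 0`, then `e = 0`: the energy
decreases at least at the rate `∫ e / (2 ‖df‖₁)`. -/
theorem IsCritical.rate_eq_zero {Γ : Type*} [Group Γ] [MulAction Γ ℍ]
    (hΓ : IsClosedSurfaceGroup Γ) {D : Set ℍ} (hD : IsFundamentalDomain Γ D (volume : Measure ℍ))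
    {ρ : Γ →* PSL(2, ℂ)} {f : ℍ → H3} (hf : IsSmooth f) (he : IsEquivariant ρ f)
    (hcrit : IsCritical D ρ f) {φ : ℝ → ℍ → H3} (hφ : IsIsomonodromicDeformation ρ f 1 φ)
    {e : ℍ → ℝ} (hcont : Continuous e) (h0 : ∀ z, 0 ≤ e z)
    (hinv : ∀ (γ : Γ) (z : ℍ), e (γ • z) = e z)
    (hshort : ∀ t ∈ Set.Ioo (0 : ℝ) 1, ∀ p v, pullback (φ t) p v ≤ pullback f p v)
    (hrate : ∀ t ∈ Set.Ioo (0 : ℝ) 1, ∀ p, t * e p ≤ (gram f p).trace - (gram (φ t) p).trace)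
    (p : ℍ) : e p = 0 := by
  set σ := schattenNorm f with hσ
  have hσ0 : ∀ z, 0 ≤ σ z := schattenNorm_nonneg f
  have hσc : Continuous σ := hf.continuous_schattenNorm
  have hsub : ∀ t ∈ Set.Ioo (0 : ℝ) 1, t ∈ Set.Ioo (-1 : ℝ) 1 := fun t ht =>
    ⟨by linarith [ht.1], ht.2⟩
  have hsq : ∀ t ∈ Set.Ioo (0 : ℝ) 1, ∀ z, schattenNorm (φ t) z ^ 2 + t * e z ≤ σ z ^ 2 := by
    intro t ht z
    have := hf.schattenNorm_sq_add_le (hφ.smooth.isSmooth (hsub t ht)) z (hshort t ht z)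
    linarith [hrate t ht z]
  -- where `σ z = 0`, both `e z` and the quotient `k z` (a division by zero) vanish
  have he0 : ∀ z, σ z = 0 → e z = 0 := by
    intro z hz
    have h1 := hsq (1 / 2) (by norm_num) z
    rw [hz] at h1
    nlinarith [sq_nonneg (schattenNorm (φ (1 / 2)) z), h0 z]
  set k : ℍ → ℝ := fun z => e z / (2 * σ z) with hk
  have hk0 : ∀ z, 0 ≤ k z := fun z => div_nonneg (h0 z) (mul_nonneg zero_le_two (hσ0 z))
  have hdec : ∀ t ∈ Set.Ioo (0 : ℝ) 1, ∀ z, schattenNorm (φ t) z ≤ σ z - t * k z := by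
    intro t ht z
    rcases (hσ0 z).eq_or_lt with hz | hz
    · have h1 := hsq t ht z
      rw [← hz, he0 z hz.symm] at h1
      have h2 : schattenNorm (φ t) z = 0 := by
        have : schattenNorm (φ t) z ^ 2 = 0 := le_antisymm (by linarith) (sq_nonneg _)
        simpa using this
      simp [h2, hk, ← hz]
    · have h1 := hsq t ht z
      have hkz : t * e z = 2 * σ z * (t * k z) := by
        simp only [hk]
        field_simp
      rw [hkz] at h1
      have h2 : σ z * (schattenNorm (φ t) z) ≤ σ z * (σ z - t * k z) := by
        nlinarith [sq_nonneg (schattenNorm (φ t) z - σ z)]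
      exact le_of_mul_le_mul_left h2 hz
  have hkm : Measurable k := hcont.measurable.div (hσc.measurable.const_mul 2)
  have hσi : IntegrableOn σ D := hΓ.integrableOn hD hσc (hΓ.schattenNorm_smul hf he)
  have hki : IntegrableOn k D := by
    refine Integrable.mono' (hσi.const_mul 2) hkm.aestronglyMeasurable
      (Filter.Eventually.of_forall fun z => ?_)
    rw [Real.norm_of_nonneg (hk0 z)]
    have := hdec (1 / 2) (by norm_num) z
    linarith [schattenNorm_nonneg (φ (1 / 2)) z]
  have hE : ∀ t ∈ Set.Ioo (0 : ℝ) 1, energy D (φ t) ≤ energy D f - t * ∫ z in D, k z := by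
    intro t ht
    have hs := hφ.smooth.isSmooth (hsub t ht)
    have hφi : IntegrableOn (schattenNorm (φ t)) D := hΓ.integrableOn hD hs.continuous_schattenNorm
      (hΓ.schattenNorm_smul hs (hφ.equivariant t (hsub t ht)))
    rw [energy, energy, ← integral_const_mul, ← integral_sub hσi (hki.const_mul t)]
    exact integral_mono hφi (hσi.sub (hki.const_mul t)) (hdec t ht)
  have hint : ∫ z in D, k z = 0 := by
    refine le_antisymm (not_lt.1 fun hpos => ?_) (integral_nonneg hk0)
    obtain ⟨δ, hδ, H⟩ := Metric.eventually_nhds_iff.1 (hcrit 1 φ hφ _ (half_pos hpos))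
    set t := min (δ / 2) (1 / 2) with htdef
    have ht0 : 0 < t := lt_min (by linarith) (by norm_num)
    have ht1 : t < 1 := (min_le_right _ _).trans_lt (by norm_num)
    have htδ : t < δ := (min_le_left _ _).trans_lt (by linarith)
    have h1 := H (y := t) (by simpa [abs_of_pos ht0] using htδ)
    have h2 := hE t ⟨ht0, ht1⟩
    rw [abs_of_pos ht0] at h1
    nlinarith [mul_pos ht0 hpos]
  have hae : ∀ᵐ z : ℍ, k z = 0 := hΓ.ae_eq_zero_of_setIntegral_eq_zero hD hki hkm hk0
    (fun γ z => by simp only [hk, hinv, hσ, hΓ.schattenNorm_smul hf he]) hint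
  have hae' : e =ᵐ[volume] fun _ => (0 : ℝ) := by
    filter_upwards [hae] with z hz
    rcases div_eq_zero_iff.1 hz with h | h
    · exact h
    · exact he0 z (by simpa using h)
  exact congrFun (hcont.ae_eq_iff_eq volume continuous_const |>.1 hae') p

/-! ### Contraction towards a point of hyperbolic space -/

theorem one_le_sq_minkowski (X x : H3) : 1 ≤ minkowski X.1 x.1 ^ 2 := by
  have := H3.one_le_neg_minkowski X x
  nlinarith

/-- The component along `x` of the image of `X` under the contraction towards `x` with factor `s`; here
`c` stands for `⟨X, x⟩`. -/
noncomputable def contractHeight (s c : ℝ) : ℝ := √(1 + s ^ 2 * (c ^ 2 - 1))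

theorem contractHeight_sq (s : ℝ) (X x : H3) :
    contractHeight s (minkowski X.1 x.1) ^ 2 = 1 + s ^ 2 * (minkowski X.1 x.1 ^ 2 - 1) :=
  Real.sq_sqrt (by nlinarith [one_le_sq_minkowski X x, sq_nonneg s])

theorem contractHeight_pos (s : ℝ) (X x : H3) : 0 < contractHeight s (minkowski X.1 x.1) :=
  Real.sqrt_pos.2 (by nlinarith [one_le_sq_minkowski X x, sq_nonneg s])

/-- The contraction of hyperbolic space towards `x` that multiplies the component of `X` orthogonal to
`x` (of length `sinh (dist X x)`) by `s`. As `X` has the component `-⟨X, x⟩ x` along `x`, its image is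
`s (X + ⟨X, x⟩ x) + contractHeight s ⟨X, x⟩ x`. -/
noncomputable def contract (x : H3) (s : ℝ) (X : H3) : H3 :=
  ⟨s • X.1 + (contractHeight s (minkowski X.1 x.1) + s * minkowski X.1 x.1) • x.1, by
    have hx := x.minkowski_self
    have hX := X.minkowski_self
    have hq := contractHeight_sq s X x
    have hq0 := contractHeight_pos s X x
    refine H3.posDef_and_det_of_minkowski_neg ((X.isHermitian.smul (IsSelfAdjoint.all s)).add
      (x.isHermitian.smul (IsSelfAdjoint.all _))) ?_ x ?_
    · simp only [minkowski_add_left, minkowski_add_right, minkowski_smul_left,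
        minkowski_smul_right, hx, hX, minkowski_comm x.1 X.1]
      linear_combination -hq
    · simp only [minkowski_add_left, minkowski_smul_left, hx]
      linarith⟩

theorem contract_one (x X : H3) : contract x 1 X = X := by
  refine Subtype.ext ?_
  have hc := H3.one_le_neg_minkowski X x
  have : contractHeight 1 (minkowski X.1 x.1) = -minkowski X.1 x.1 := by
    rw [contractHeight, ← Real.sqrt_sq (by linarith : 0 ≤ -minkowski X.1 x.1)]
    congr 1
    ring
  simp [contract, this]

theorem minkowski_smul_smul (A : SL(2, ℂ)) (X x : H3) :
    minkowski (A • X).1 (A • x).1 = minkowski X.1 x.1 := by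
  rw [coe_smul, coe_smul, minkowski_conj]

theorem minkowski_smul_of_fixed {A : SL(2, ℂ)} {x : H3} (hA : A • x = x) (X : H3) :
    minkowski (A • X).1 x.1 = minkowski X.1 x.1 := by
  conv_lhs => rw [← hA]
  exact minkowski_smul_smul A X x

theorem contract_smul {A : SL(2, ℂ)} {x : H3} (hA : A • x = x) (s : ℝ) (X : H3) :
    contract x s (A • X) = A • contract x s X := by
  have h1 := minkowski_smul_of_fixed hA X
  have h2 : A.1 * x.1 * A.1ᴴ = x.1 := congrArg Subtype.val hA
  refine Subtype.ext ?_
  change s • (A.1 * X.1 * A.1ᴴ) + (contractHeight s (minkowski (A • X).1 x.1) +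
    s * minkowski (A • X).1 x.1) • x.1 = A.1 * (s • X.1 + (contractHeight s (minkowski X.1 x.1) +
      s * minkowski X.1 x.1) • x.1) * A.1ᴴ
  simp only [h1, mul_add, add_mul, Matrix.mul_smul, Matrix.smul_mul, h2]

variable {f : ℍ → H3}

theorem IsSmooth.isSmoothFamily_contract (hf : IsSmooth f) (x : H3) :
    IsSmoothFamily 1 fun t z => contract x (1 - t) (f z) := by
  intro i j
  set U : Set (ℂ × ℝ) := {w : ℂ | 0 < w.im} ×ˢ Set.Ioo (-1) 1
  have hF : ∀ i j, ContDiffOn ℝ ∞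
      (fun q : ℂ × ℝ => (f (UpperHalfPlane.ofComplex q.1)).1 i j) U := fun i j =>
    (hf i j).comp contDiff_fst.contDiffOn fun q hq => hq.1
  have hc := contDiffOn_minkowski (X := fun q : ℂ × ℝ => (f (UpperHalfPlane.ofComplex q.1)).1) hF x.1
  have hs : ContDiffOn ℝ ∞ (fun q : ℂ × ℝ => 1 - q.2) U :=
    contDiffOn_const.sub contDiff_snd.contDiffOn
  have hq := (contDiffOn_const (c := (1 : ℝ)).add ((hs.pow 2).mul ((hc.pow 2).sub
    (contDiffOn_const (c := (1 : ℝ)))))).sqrt fun q _ => by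
      have := one_le_sq_minkowski (f (UpperHalfPlane.ofComplex q.1)) x
      nlinarith [sq_nonneg (1 - q.2)]
  exact (hs.smul (hF i j)).add ((hq.add (hs.mul hc)).smul (contDiffOn_const (c := x.1 i j)))

theorem IsSmooth.contract (hf : IsSmooth f) (x : H3) {t : ℝ} (ht : t ∈ Set.Ioo (-1 : ℝ) 1) :
    IsSmooth fun z => SchattenEnergy.contract x (1 - t) (f z) :=
  (hf.isSmoothFamily_contract x).isSmooth ht

theorem IsSmooth.differential_contract (hf : IsSmooth f) (x : H3) {s : ℝ}
    (hs : IsSmooth fun z => SchattenEnergy.contract x s (f z)) (p : ℍ) (v : ℂ) :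
    differential (fun z => SchattenEnergy.contract x s (f z)) p v =
      s • differential f p v +
        (s ^ 2 * minkowski (f p).1 x.1 * minkowski (differential f p v) x.1 /
            contractHeight s (minkowski (f p).1 x.1) +
          s * minkowski (differential f p v) x.1) • x.1 := by
  ext i j
  refine hs.differential_apply_eq ?_
  have hF := hf.hasDerivAt_line p v
  have hc := hasDerivAt_minkowski hF (Z := fun _ => x.1) (Z' := 0)
    (fun i j => hasDerivAt_const (0 : ℝ) (x.1 i j))
  have hm0 : ∀ W, minkowski W 0 = 0 := fun W => by simp [minkowski]
  simp only [hm0, add_zero] at hc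
  have hpos := contractHeight_pos s (f p) x
  have hq := (((hc.pow 2).sub_const 1).const_mul (s ^ 2)).const_add 1 |>.sqrt (by
    simpa [contractHeight] using (Real.sqrt_pos.1 hpos).ne')
  refine (((hF i j).const_smul s).add ((hq.add (hc.const_mul s)).smul_const (x.1 i j))).congr_deriv ?_
  simp only [Matrix.add_apply, Matrix.smul_apply, contractHeight]
  congr 2
  simp
  field_simp

/-- The contraction by a factor `s < 1` shortens tangent vectors by a definite factor. -/
theorem IsSmooth.pullback_contract_le (hf : IsSmooth f) (x : H3) {s : ℝ}
    (hs : IsSmooth fun z => SchattenEnergy.contract x s (f z)) (hs0 : 0 ≤ s) (hs1 : s ≤ 1) (p : ℍ)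
    (v : ℂ) :
    pullback (fun z => SchattenEnergy.contract x s (f z)) p v ≤
      (1 - (1 - s ^ 2) / minkowski (f p).1 x.1 ^ 2) *
        pullback f p v := by
  rw [pullback, pullback, hf.differential_contract x hs]
  have hY := hf.isTangent p v
  have hcs := hY.sq_minkowski_le x
  have hYY := hY.minkowski_self_nonneg
  have hq := contractHeight_sq s (f p) x
  have hq0 := contractHeight_pos s (f p) x
  have hc1 := one_le_sq_minkowski (f p) x
  have hx := x.minkowski_self
  simp only [minkowski_add_left, minkowski_add_right, minkowski_smul_left, minkowski_smul_right, hx,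
    minkowski_comm x.1 (differential f p v)]
  generalize minkowski (differential f p v) (differential f p v) = g at *
  generalize minkowski (differential f p v) x.1 = m at *
  generalize contractHeight s (minkowski (f p).1 x.1) = q at *
  generalize minkowski (f p).1 x.1 = c at *
  have hs2 : 0 ≤ 1 - s ^ 2 := by nlinarith
  have hq2 : 0 < q ^ 2 := by positivity
  have hc2 : 0 < c ^ 2 := by linarith
  -- the length of the image, in terms of `⟨Y, Y⟩ = g` and `⟨Y, x⟩ = m`
  have e1 : s * (s * g) + s * ((s ^ 2 * c * m / q + s * m) * m) +
      ((s ^ 2 * c * m / q + s * m) * (s * m) +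
        (s ^ 2 * c * m / q + s * m) * ((s ^ 2 * c * m / q + s * m) * -1)) =
      s ^ 2 * (g + m ^ 2 * ((1 - s ^ 2) / q ^ 2)) := by
    field_simp
    linear_combination (s ^ 2 * m ^ 2) * hq
  have e2 : s ^ 2 * (g + m ^ 2 * ((1 - s ^ 2) / q ^ 2)) ≤ (1 - (1 - s ^ 2) / q ^ 2) * g := by
    have h3 : m ^ 2 * ((1 - s ^ 2) / q ^ 2) ≤ (c ^ 2 - 1) * g * ((1 - s ^ 2) / q ^ 2) :=
      mul_le_mul_of_nonneg_right hcs (by positivity)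
    have h4 : s ^ 2 * (g + (c ^ 2 - 1) * g * ((1 - s ^ 2) / q ^ 2)) =
        (1 - (1 - s ^ 2) / q ^ 2) * g := by
      field_simp
      linear_combination (g * (s ^ 2 - 1)) * hq
    rw [← h4]
    exact mul_le_mul_of_nonneg_left (by linarith) (sq_nonneg s)
  have e3 : (1 - s ^ 2) / c ^ 2 ≤ (1 - s ^ 2) / q ^ 2 := by
    refine div_le_div_of_nonneg_left hs2 hq2 ?_
    rw [hq]
    nlinarith
  have e4 : (1 - (1 - s ^ 2) / q ^ 2) * g ≤ (1 - (1 - s ^ 2) / c ^ 2) * g :=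
    mul_le_mul_of_nonneg_right (by linarith) hYY
  linarith

/-- A critical map is constant if the representation fixes a point `x` of hyperbolic space, as the
contraction towards `x` would decrease its energy to first order. -/
theorem IsCritical.differential_eq_zero {Γ : Type*} [Group Γ] [MulAction Γ ℍ]
    (hΓ : IsClosedSurfaceGroup Γ) {D : Set ℍ} (hD : IsFundamentalDomain Γ D (volume : Measure ℍ))
    {ρ : Γ →* PSL(2, ℂ)} (hf : IsSmooth f) (he : IsEquivariant ρ f)
    (hcrit : IsCritical D ρ f) {x : H3} (hx : ∀ γ, ρ γ • x = x) (p : ℍ) (v : ℂ) :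
    differential f p v = 0 := by
  have hlift : ∀ γ, ∃ A : SL(2, ℂ), A • x = x ∧ ∀ X : H3, ρ γ • X = A • X := by
    intro γ
    obtain ⟨A, hA⟩ := QuotientGroup.mk_surjective (ρ γ)
    refine ⟨A, ?_, fun X => by rw [← hA]; rfl⟩
    have := hx γ
    rwa [← hA] at this
  obtain ⟨c, hc⟩ : ∃ c : ℍ → ℝ, ∀ z, c z = minkowski (f z).1 x.1 := ⟨_, fun _ => rfl⟩
  have hc0 : ∀ z, 0 < c z ^ 2 := fun z => by
    rw [hc]
    exact zero_lt_one.trans_le (one_le_sq_minkowski (f z) x)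
  have hφ : IsIsomonodromicDeformation ρ f 1 fun t z => contract x (1 - t) (f z) := by
    refine ⟨one_pos, hf.isSmoothFamily_contract x, fun t _ γ z => ?_, ?_⟩
    · obtain ⟨A, hA, hA'⟩ := hlift γ
      simp only [he γ z, hA', contract_smul hA]
    · funext z
      simp [contract_one]
  have key : ∀ t ∈ Set.Ioo (0 : ℝ) 1, ∀ q w,
      pullback (fun z => contract x (1 - t) (f z)) q w +
        t * (pullback f q w / c q ^ 2) ≤
      pullback f q w := by
    intro t ht q w
    have h1 := hf.pullback_contract_le x (hf.contract x ⟨by linarith [ht.1], ht.2⟩)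
      (by linarith [ht.2]) (by linarith [ht.1]) q w
    have h2 := div_nonneg (hf.pullback_nonneg q w) (hc0 q).le
    have h3 : (1 - (1 - (1 - t) ^ 2) / minkowski (f q).1 x.1 ^ 2) *
        pullback f q w =
        pullback f q w - (t + t * (1 - t)) *
          (pullback f q w / c q ^ 2) := by
      rw [hc]
      ring
    rw [h3] at h1
    have h4 : 0 ≤ t * (1 - t) := mul_nonneg ht.1.le (by linarith [ht.2])
    nlinarith [mul_nonneg h4 h2]
  have hQ := hf.pullback_nonneg
  have h0 : (gram f p).trace / c p ^ 2 = 0 := by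
    refine hcrit.rate_eq_zero hΓ hD hf he hφ (e := fun z => (gram f z).trace / c z ^ 2)
      ?_ (fun z => ?_) (fun γ z => ?_) (fun t ht q w => ?_) (fun t ht q => ?_) p
    · refine hf.continuous_trace_gram.div ?_ fun z => (hc0 z).ne'
      rw [funext hc]
      exact (continuous_minkowski (Z := fun _ => x.1) hf.continuous_apply
        fun i j => continuous_const).pow 2
    · exact div_nonneg (by rw [trace_gram]; exact add_nonneg (hQ _ _) (hQ _ _)) (hc0 z).le
    · obtain ⟨A, hA, hA'⟩ := hlift γ
      have : c (γ • z) = c z := by rw [hc, he γ z, hA', minkowski_smul_of_fixed hA, hc]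
      rw [this, (hΓ.gram_smul hf he γ z).1]
    · have := key t ht q w
      have h2 := mul_nonneg ht.1.le (div_nonneg (hQ q w) (hc0 q).le)
      linarith
    · have k0 := key t ht q (frame q 0)
      have k1 := key t ht q (frame q 1)
      rw [trace_gram, trace_gram, add_div, mul_add]
      linarith
  rw [div_eq_zero_iff, or_iff_left (hc0 p).ne', trace_gram] at h0
  have e0 : differential f p (frame p 0) = 0 :=
    (hf.isTangent p _).eq_zero (le_antisymm (by rw [← pullback]; linarith [hQ p (frame p 1)]) (hQ p _))
  have e1 : differential f p (frame p 1) = 0 :=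
    (hf.isTangent p _).eq_zero (le_antisymm (by rw [← pullback]; linarith [hQ p (frame p 0)]) (hQ p _))
  obtain ⟨a, b, rfl⟩ := exists_frame p v
  rw [map_add, map_smul, map_smul, e0, e1, smul_zero, smul_zero, add_zero]

/-! ### The flow towards an ideal point -/

/-- The null vector of the Minkowski space that spans the ray ending in the ideal point `[1 : 0]`. -/
noncomputable def nullVector : Matrix (Fin 2) (Fin 2) ℂ := !![1, 0; 0, 0]

theorem nullVector_isHermitian : nullVector.IsHermitian := by
  ext i j
  fin_cases i <;> fin_cases j <;> simp [nullVector]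

theorem minkowski_nullVector {Y : Matrix (Fin 2) (Fin 2) ℂ} :
    minkowski Y nullVector = -(Y 1 1).re / 2 := by
  simp [minkowski, nullVector, Matrix.trace_fin_two, Matrix.mul_apply]

theorem minkowski_nullVector_self : minkowski nullVector nullVector = 0 := by
  rw [minkowski_nullVector]
  simp [nullVector]

/-- The time-`-log s` map of the geodesic flow towards the ideal point `[1 : 0]`. In the coordinates
`z = X₀₁ / X₁₁`, `h = 1 / X₁₁` of the upper half-space it is `(z, h) ↦ (z, h / s)`. It is extended by
the identity to `s ≤ 0`. -/
noncomputable def flow (s : ℝ) (X : H3) : H3 :=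
  if hs : 0 < s then
    ⟨s • X.1 + ((s⁻¹ - s) / (X.1 1 1).re) • nullVector, by
      have hX := X.minkowski_self
      have hd := X.re_pos 1
      refine H3.posDef_and_det_of_minkowski ((X.isHermitian.smul (IsSelfAdjoint.all s)).add
        (nullVector_isHermitian.smul (IsSelfAdjoint.all _))) ?_ ?_
      · simp only [minkowski_add_left, minkowski_add_right, minkowski_smul_left,
          minkowski_smul_right, hX, minkowski_comm nullVector X.1, minkowski_nullVector_self]
        rw [minkowski_nullVector]
        field_simp
        ring
      · simpa [nullVector] using mul_pos hs hd⟩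
  else X

theorem coe_flow {s : ℝ} (hs : 0 < s) (X : H3) :
    (flow s X).1 = s • X.1 + ((s⁻¹ - s) / (X.1 1 1).re) • nullVector :=
  congrArg Subtype.val (dif_pos hs)

theorem flow_one (X : H3) : flow 1 X = X :=
  Subtype.ext (by simp [coe_flow])

theorem smul_apply_of_upper {A : SL(2, ℂ)} (hA : A.1 1 0 = 0) (X : H3) :
    (A • X).1 1 1 = Complex.normSq (A.1 1 1) * X.1 1 1 ∧
      (A • X).1 0 1 = (A.1 0 0 * X.1 0 1 + A.1 0 1 * X.1 1 1) * star (A.1 1 1) := by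
  constructor <;> simp [coe_smul, Matrix.mul_apply, hA, Complex.normSq_eq_conj_mul_self]
  ring

theorem det_of_upper {A : SL(2, ℂ)} (hA : A.1 1 0 = 0) : A.1 0 0 * A.1 1 1 = 1 := by
  have := A.2
  rwa [Matrix.det_fin_two, hA, mul_zero, sub_zero] at this

/-- The flow towards `[1 : 0]` commutes with the stabilizer of `[1 : 0]`. -/
theorem flow_smul {A : SL(2, ℂ)} (hA : A.1 1 0 = 0) {s : ℝ} (hs : 0 < s) (X : H3) :
    flow s (A • X) = A • flow s X := by
  refine Subtype.ext ?_
  have hdet := det_of_upper hA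
  have hn : A.1 1 1 ≠ 0 := right_ne_zero_of_mul_eq_one hdet
  have hN : A.1 * nullVector * A.1ᴴ = (Complex.normSq (A.1 1 1))⁻¹ • nullVector := by
    have h0 : A.1 0 0 = (A.1 1 1)⁻¹ := eq_inv_of_mul_eq_one_left hdet
    ext i j
    fin_cases i <;> fin_cases j <;>
      simp [nullVector, Matrix.mul_apply, hA, h0, Complex.normSq_eq_conj_mul_self, mul_comm]
  have hre : ((A • X).1 1 1).re = Complex.normSq (A.1 1 1) * (X.1 1 1).re := by
    rw [(smul_apply_of_upper hA X).1, Complex.re_ofReal_mul]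
  rw [coe_flow hs, coe_smul A (flow s X), coe_flow hs, hre, coe_smul]
  simp only [mul_add, add_mul, Matrix.mul_smul, Matrix.smul_mul, hN, smul_smul]
  congr 2
  have : Complex.normSq (A.1 1 1) ≠ 0 := by simpa using hn
  have := (X.re_pos 1).ne'
  field_simp

theorem IsSmooth.isSmoothFamily_flow (hf : IsSmooth f) :
    IsSmoothFamily 1 fun t z => flow (1 - t) (f z) := by
  intro i j
  set U : Set (ℂ × ℝ) := {w : ℂ | 0 < w.im} ×ˢ Set.Ioo (-1) 1
  have hF : ∀ i j, ContDiffOn ℝ ∞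
      (fun q : ℂ × ℝ => (f (UpperHalfPlane.ofComplex q.1)).1 i j) U := fun i j =>
    (hf i j).comp contDiff_fst.contDiffOn fun q hq => hq.1
  have hs : ContDiffOn ℝ ∞ (fun q : ℂ × ℝ => 1 - q.2) U :=
    contDiffOn_const.sub contDiff_snd.contDiffOn
  have hs0 : ∀ q ∈ U, 0 < 1 - q.2 := fun q hq => sub_pos.2 hq.2.2
  have hd := Complex.reCLM.contDiff.comp_contDiffOn (hF 1 1)
  have hk := ((hs.inv fun q hq => (hs0 q hq).ne').sub hs).div hd fun q _ => (H3.re_pos _ 1).ne'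
  refine ((hs.smul (hF i j)).add (hk.smul (contDiffOn_const (c := nullVector i j)))).congr
    fun q hq => ?_
  rw [coe_flow (hs0 q hq)]
  rfl

theorem IsSmooth.flow (hf : IsSmooth f) {s : ℝ} (hs0 : 0 < s) (hs1 : s ≤ 1) :
    IsSmooth fun z => SchattenEnergy.flow s (f z) := by
  have := hf.isSmoothFamily_flow.isSmooth (t := 1 - s) ⟨by linarith, by linarith⟩
  simpa using this

/-- The square of the length of the horizontal part `dz` of `df v`, where `(|dz|² + dh²) / h²` is the
metric of the upper half-space. -/
noncomputable def horizontal (f : ℍ → H3) (p : ℍ) (v : ℂ) : ℝ :=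
  Complex.normSq (differential f p v 0 1 * (f p).1 1 1 - (f p).1 0 1 * differential f p v 1 1) /
    ((f p).1 1 1).re ^ 2

theorem horizontal_nonneg (f : ℍ → H3) (p : ℍ) (v : ℂ) : 0 ≤ horizontal f p v :=
  div_nonneg (Complex.normSq_nonneg _) (sq_nonneg _)

/-- The flow multiplies the square of the length of the horizontal part by `s²`, and preserves the
length of the vertical part. -/
theorem IsSmooth.pullback_flow (hf : IsSmooth f) {s : ℝ} (hs0 : 0 < s) (hs1 : s ≤ 1) (p : ℍ)
    (v : ℂ) : pullback (fun z => SchattenEnergy.flow s (f z)) p v =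
      pullback f p v - (1 - s ^ 2) * horizontal f p v := by
  have hdiff : differential (fun z => SchattenEnergy.flow s (f z)) p v = s • differential f p v +
      (-((s⁻¹ - s) * (differential f p v 1 1).re / ((f p).1 1 1).re ^ 2)) • nullVector := by
    ext i j
    refine (hf.flow hs0 hs1).differential_apply_eq ?_
    have hF := hf.hasDerivAt_line p v
    have hd := Complex.reCLM.hasFDerivAt.comp_hasDerivAt (0 : ℝ) (hF 1 1)
    have hk := (hasDerivAt_const (0 : ℝ) (s⁻¹ - s)).div hd (H3.re_pos _ 1).ne'
    have := ((hF i j).const_smul s).add (hk.smul_const (nullVector i j))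
    refine (this.congr_deriv ?_).congr_of_eventuallyEq (Filter.Eventually.of_forall fun r => ?_)
    · simp
      ring
    · change (SchattenEnergy.flow s _).1 i j = _
      rw [coe_flow hs0]
      rfl
  have hY := (hf.isTangent p v).minkowski_self_mul
  have hd := (H3.re_pos (f p) 1).ne'
  rw [pullback, pullback, hdiff, horizontal, eq_sub_iff_add_eq.2 hY.symm]
  simp only [minkowski_add_left, minkowski_add_right, minkowski_smul_left,
    minkowski_smul_right, minkowski_comm nullVector (differential f p v), minkowski_nullVector_self]
  rw [minkowski_nullVector]
  field_simp
  ring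

/-- If the representation fixes the ideal point `B [1 : 0]`, then a critical map has no horizontal part
with respect to this point, as the flow towards it would decrease its energy to first order. -/
theorem IsCritical.horizontal_eq_zero {Γ : Type*} [Group Γ] [MulAction Γ ℍ]
    (hΓ : IsClosedSurfaceGroup Γ) {D : Set ℍ} (hD : IsFundamentalDomain Γ D (volume : Measure ℍ))
    {ρ : Γ →* PSL(2, ℂ)} (hf : IsSmooth f) (he : IsEquivariant ρ f)
    (hcrit : IsCritical D ρ f) (B : SL(2, ℂ))
    (hB : ∀ γ (A : SL(2, ℂ)), (A : PSL(2, ℂ)) = ρ γ → (B⁻¹ * A * B).1 1 0 = 0) (p : ℍ) (v : ℂ) :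
    horizontal (fun z => B⁻¹ • f z) p v = 0 := by
  set f' : ℍ → H3 := fun z => B⁻¹ • f z with hf'def
  have hf' : IsSmooth f' := hf.smul B⁻¹
  have hff' : ∀ z, f z = B • f' z := fun z => (smul_inv_smul B (f z)).symm
  have hφs : IsSmoothFamily 1 fun t z => B • SchattenEnergy.flow (1 - t) (f' z) :=
    contDiffOn_smul (X := fun q : ℂ × ℝ =>
      SchattenEnergy.flow (1 - q.2) (f' (UpperHalfPlane.ofComplex q.1))) hf'.isSmoothFamily_flow B
  have hequiv : ∀ s > 0, IsEquivariant ρ fun z => B • SchattenEnergy.flow s (f' z) := by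
    intro s hs γ z
    obtain ⟨A, hA⟩ := QuotientGroup.mk_surjective (ρ γ)
    have h1 : f' (γ • z) = (B⁻¹ * A * B) • f' z := by
      simp only [hf'def, he γ z, ← hA, mul_smul, smul_inv_smul]
      rfl
    simp only [h1, flow_smul (hB γ A hA) hs, ← hA, mk_smul, smul_smul]
    group
  have hφ : IsIsomonodromicDeformation ρ f 1 fun t z => B • SchattenEnergy.flow (1 - t) (f' z) := by
    refine ⟨one_pos, hφs, fun t ht => hequiv _ (sub_pos.2 ht.2), ?_⟩
    funext z
    simp [flow_one, hff']
  have hpull : ∀ {g h : ℍ → H3}, IsSmooth g → (∀ z, h z = B • g z) → ∀ q w,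
      pullback h q w = pullback g q w := by
    intro g h hg hgh q w
    have hh : IsSmooth h := by
      rw [funext hgh]
      exact hg.smul B
    rw [pullback, hg.differential_smul hh B hgh, minkowski_conj, pullback]
  have key : ∀ t ∈ Set.Ioo (0 : ℝ) 1, ∀ q w,
      pullback (fun z => B • SchattenEnergy.flow (1 - t) (f' z)) q w =
        pullback f q w - (t + t * (1 - t)) * horizontal f' q w := by
    intro t ht q w
    rw [hpull (hf'.flow (by linarith [ht.2]) (by linarith [ht.1])) (fun _ => rfl), hpull hf' hff',
      hf'.pullback_flow (by linarith [ht.2]) (by linarith [ht.1])]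
    ring
  have hrate : ∀ t ∈ Set.Ioo (0 : ℝ) 1, ∀ q, (gram f q).trace -
      (gram (fun z => B • SchattenEnergy.flow (1 - t) (f' z)) q).trace =
        (t + t * (1 - t)) * (horizontal f' q (frame q 0) + horizontal f' q (frame q 1)) := by
    intro t ht q
    rw [trace_gram, trace_gram, key t ht, key t ht]
    ring
  have hpos : ∀ t ∈ Set.Ioo (0 : ℝ) 1, t ≤ t + t * (1 - t) := fun t ht =>
    le_add_of_nonneg_right (mul_nonneg ht.1.le (by linarith [ht.2]))
  have hH := horizontal_nonneg f'
  have h0 : horizontal f' p (frame p 0) + horizontal f' p (frame p 1) = 0 := by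
    refine hcrit.rate_eq_zero hΓ hD hf he hφ
      (e := fun q => horizontal f' q (frame q 0) + horizontal f' q (frame q 1))
      ?_ (fun z => add_nonneg (hH _ _) (hH _ _)) (fun γ z => ?_) (fun t ht q w => ?_)
      (fun t ht q => ?_) p
    · have hc : ∀ k, Continuous fun q => horizontal f' q (frame q k) := by
        intro k
        have h1 := hf'.continuous_apply
        have h2 := hf'.continuous_differential k
        refine (Complex.continuous_normSq.comp (((h2 0 1).mul (h1 1 1)).sub
          ((h1 0 1).mul (h2 1 1)))).div ((Complex.continuous_re.comp (h1 1 1)).pow 2) fun q => ?_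
        exact pow_ne_zero 2 (H3.re_pos (f' q) 1).ne'
      exact (hc 0).add (hc 1)
    · -- the rate is the difference of two invariant functions, up to a constant
      have ht : (1 / 2 : ℝ) ∈ Set.Ioo (0 : ℝ) 1 := by norm_num
      have h1 := hrate _ ht z
      have h2 := hrate _ ht (γ • z)
      have hs : IsSmooth fun z => B • SchattenEnergy.flow (1 - 1 / 2) (f' z) :=
        hφs.isSmooth (by norm_num)
      rw [(hΓ.gram_smul hf he γ z).1, (hΓ.gram_smul hs (hequiv _ (by norm_num)) γ z).1, h1] at h2
      exact (mul_left_cancel₀ (by norm_num) h2).symm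
    · rw [key t ht]
      exact sub_le_self _ (mul_nonneg (ht.1.le.trans (hpos t ht)) (hH q w))
    · rw [hrate t ht]
      exact mul_le_mul_of_nonneg_right (hpos t ht) (add_nonneg (hH _ _) (hH _ _))
  have hlin : ∀ k, horizontal f' p (frame p k) = 0 →
      differential f' p (frame p k) 0 1 * (f' p).1 1 1 -
        (f' p).1 0 1 * differential f' p (frame p k) 1 1 = 0 := by
    intro k hk
    rw [horizontal, div_eq_zero_iff, or_iff_left (pow_ne_zero 2 (H3.re_pos (f' p) 1).ne'),
      Complex.normSq_eq_zero] at hk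
    exact hk
  have e0 := hlin 0 (by linarith [hH p (frame p 0), hH p (frame p 1)])
  have e1 := hlin 1 (by linarith [hH p (frame p 0), hH p (frame p 1)])
  obtain ⟨a, b, rfl⟩ := exists_frame p v
  rw [horizontal, div_eq_zero_iff, Complex.normSq_eq_zero]
  left
  rw [map_add, map_smul, map_smul]
  simp only [Matrix.add_apply, Matrix.smul_apply, Complex.real_smul]
  linear_combination (a : ℂ) * e0 + (b : ℂ) * e1

/-- A map without horizontal part has rank at most one. -/
theorem finrank_range_differential_le_one (hf : IsSmooth f) (B : SL(2, ℂ)) (p : ℍ)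
    (h : ∀ v, horizontal (fun z => B⁻¹ • f z) p v = 0) :
    Module.finrank ℝ (LinearMap.range (differential f p)) ≤ 1 := by
  set f' : ℍ → H3 := fun z => B⁻¹ • f z with hf'def
  have hf' : IsSmooth f' := hf.smul B⁻¹
  let L : ℂ →ₗ[ℝ] ℝ :=
    { toFun := fun v => (differential f' p v 1 1).re
      map_add' := fun v w => by simp
      map_smul' := fun c v => by rw [map_smul]; simp }
  have hker : LinearMap.ker L ≤ LinearMap.ker (differential f p) := by
    intro v hv
    have h1 : differential f' p v = 0 := by
      refine (hf'.isTangent p v).eq_zero_of_normSq_eq_zero ?_ hv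
      have := h v
      rwa [horizontal, div_eq_zero_iff,
        or_iff_left (pow_ne_zero 2 (H3.re_pos (f' p) 1).ne')] at this
    rw [LinearMap.mem_ker, hf'.differential_smul hf B (fun z => (smul_inv_smul B (f z)).symm), h1]
    simp
  have h1 := L.finrank_range_add_finrank_ker
  have h2 := (differential f p).finrank_range_add_finrank_ker
  have h3 := Submodule.finrank_mono hker
  have h4 : Module.finrank ℝ (LinearMap.range L) ≤ 1 := by
    simpa using Submodule.finrank_le (LinearMap.range L)
  omega

/-- A map without horizontal part takes values in a geodesic ending in `[1 : 0]`, on which the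
coordinate `z = X₀₁ / X₁₁` is constant. -/
theorem exists_eq_mul_of_horizontal_eq_zero (hf : IsSmooth f) (h : ∀ p v, horizontal f p v = 0) :
    ∃ z₀ : ℂ, ∀ p, (f p).1 0 1 = z₀ * (f p).1 1 1 := by
  have hne : ∀ X : H3, X.1 1 1 ≠ 0 := fun X hX => by simpa [hX] using X.re_pos 1
  set F : ℂ → ℂ := fun w => (f (UpperHalfPlane.ofComplex w)).1 0 1 /
    (f (UpperHalfPlane.ofComplex w)).1 1 1 with hF
  have hder : ∀ w ∈ {w : ℂ | 0 < w.im}, HasFDerivAt F (0 : ℂ →L[ℝ] ℂ) w := by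
    intro w hw
    have hd := (hf.differentiableAt ⟨w, hw⟩ 0 1).mul
      ((hf.differentiableAt ⟨w, hw⟩ 1 1).inv (hne _))
    have hd' : DifferentiableAt ℝ F w := by
      simpa only [hF, div_eq_mul_inv] using! hd
    have hzero : fderiv ℝ F w = 0 := by
      ext1 v
      have hline : HasDerivAt (fun s : ℝ => w + s * v) v 0 := by
        simpa using ((Complex.ofRealCLM.hasDerivAt (x := (0 : ℝ))).mul_const v).const_add w
      have h1 := hd'.hasFDerivAt
      have hw0 : w = w + ((0 : ℝ) : ℂ) * v := by simp
      rw [hw0] at h1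
      have h2 := h1.comp_hasDerivAt (0 : ℝ) hline
      rw [← hw0] at h2
      have h3 := (hf.hasDerivAt_line ⟨w, hw⟩ v 0 1).div (hf.hasDerivAt_line ⟨w, hw⟩ v 1 1) (hne _)
      have h4 := h2.unique h3
      rw [h4]
      have h5 := h ⟨w, hw⟩ v
      rw [horizontal, div_eq_zero_iff, or_iff_left (pow_ne_zero 2 (H3.re_pos _ 1).ne'),
        Complex.normSq_eq_zero] at h5
      have h6 : UpperHalfPlane.ofComplex w = ⟨w, hw⟩ := UpperHalfPlane.ofComplex_apply_of_im_pos hw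
      simp only [Complex.ofReal_zero, zero_mul, add_zero, h6]
      rw [h5, zero_div]
      rfl
    rw [← hzero]
    exact hd'.hasFDerivAt
  refine ⟨F UpperHalfPlane.I, fun p => ?_⟩
  have hconv : Convex ℝ {w : ℂ | 0 < w.im} := convex_halfSpace_im_gt 0
  have hconst : F p = F UpperHalfPlane.I := by
    refine hconv.is_const_of_fderivWithin_eq_zero (𝕜 := ℝ)
      (fun w hw => (hder w hw).differentiableAt.differentiableWithinAt) (fun w hw => ?_)
      p.im_pos UpperHalfPlane.I.im_pos
    rw [fderivWithin_of_isOpen isOpen_im_pos hw, (hder w hw).fderiv]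
  rw [← hconst]
  simp only [hF, UpperHalfPlane.ofComplex_apply]
  rw [div_mul_cancel₀ _ (hne _)]

/-! ### Ideal points and unipotent elements -/

theorem mk_eq_mk_iff_det {v w : Fin 2 → ℂ} (hv : v ≠ 0) (hw : w ≠ 0) :
    Projectivization.mk ℂ v hv = Projectivization.mk ℂ w hw ↔ v 0 * w 1 - v 1 * w 0 = 0 := by
  rw [Projectivization.mk_eq_mk_iff']
  constructor
  · rintro ⟨a, rfl⟩
    simp
    ring
  · intro h
    by_cases h0 : w 0 = 0
    · have h1 : w 1 ≠ 0 := fun h1 => hw (by ext i; fin_cases i <;> simp [h0, h1])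
      refine ⟨v 1 / w 1, ?_⟩
      ext i
      fin_cases i
      · have : v 0 = 0 := by simpa [h0, h1] using h
        simp [h0, this]
      · simp [h1]
    · refine ⟨v 0 / w 0, ?_⟩
      ext i
      fin_cases i
      · simp [h0]
      · simp
        field_simp
        linear_combination h

theorem smul_mk_eq_self_iff (A : SL(2, ℂ)) {v : Fin 2 → ℂ} (hv : v ≠ 0) :
    (A : PSL(2, ℂ)) • Projectivization.mk ℂ v hv = Projectivization.mk ℂ v hv ↔
      (A.1 0 0 * v 0 + A.1 0 1 * v 1) * v 1 - (A.1 1 0 * v 0 + A.1 1 1 * v 1) * v 0 = 0 := by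
  rw [Matrix.ProjectiveSpecialLinearGroup.smul_proj_mk, Projectivization.smul_mk, mk_eq_mk_iff_det]
  have h : A • v = A.1 *ᵥ v := rfl
  simp [h, Matrix.mulVec, dotProduct]

theorem det_eq_zero_of_isNilpotent {M : Matrix (Fin 2) (Fin 2) ℂ} (hM : IsNilpotent M) :
    M.det = 0 := by
  obtain ⟨k, hk⟩ := hM
  have : M.det ^ k = 0 := by rw [← Matrix.det_pow, hk, Matrix.det_zero]
  exact eq_zero_of_pow_eq_zero this

theorem trace_eq_zero_of_isNilpotent {M : Matrix (Fin 2) (Fin 2) ℂ} (hM : IsNilpotent M) :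
    M.trace = 0 :=
  (Matrix.isNilpotent_trace_of_isNilpotent hM).eq_zero

theorem eq_or_eq_neg_of_coe_eq {A C : SL(2, ℂ)} (h : (A : PSL(2, ℂ)) = C) :
    C.1 = A.1 ∨ C.1 = -A.1 := by
  obtain ⟨r, hr, hrA⟩ := Matrix.SpecialLinearGroup.mem_center_iff.1 (QuotientGroup.eq.1 h)
  have hC : C.1 = A.1 * (A⁻¹ * C).1 := by
    rw [← Matrix.SpecialLinearGroup.coe_mul, mul_inv_cancel_left]
  have hr' : r = 1 ∨ r = -1 := by simpa using hr
  rw [hC, ← hrA]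
  rcases hr' with rfl | rfl
  · left
    rw [map_one, mul_one]
  · right
    rw [map_neg, map_one, mul_neg, mul_one]

theorem trace_of_isUnipotent {A : SL(2, ℂ)} (h : IsUnipotent (A : PSL(2, ℂ))) :
    A.1.trace = 2 ∨ A.1.trace = -2 := by
  obtain ⟨C, hC, hnil⟩ := h
  have ht : C.1.trace = 2 := by
    have := trace_eq_zero_of_isNilpotent hnil
    rw [Matrix.trace_sub, Matrix.trace_one, Fintype.card_fin] at this
    simpa using sub_eq_zero.1 this
  rcases eq_or_eq_neg_of_coe_eq hC with h | h
  · left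
    rw [h, ht]
  · right
    rw [h, Matrix.trace_neg, ht]

/-- A nilpotent matrix annihilates its eigenvectors. -/
theorem mulVec_eq_zero_of_isNilpotent {M : Matrix (Fin 2) (Fin 2) ℂ} (hM : IsNilpotent M)
    {v : Fin 2 → ℂ} (hv : v ≠ 0) (h : (M *ᵥ v) 0 * v 1 - (M *ᵥ v) 1 * v 0 = 0) : M *ᵥ v = 0 := by
  by_contra hne
  obtain ⟨a, ha⟩ := (Projectivization.mk_eq_mk_iff' ℂ (M *ᵥ v) v hne hv).1
    ((mk_eq_mk_iff_det hne hv).2 h)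
  obtain ⟨k, hk⟩ := hM
  have hpow : ∀ n : ℕ, M ^ n *ᵥ v = a ^ n • v := by
    intro n
    induction n with
    | zero => simp
    | succ n ih => rw [pow_succ, ← Matrix.mulVec_mulVec, ← ha, Matrix.mulVec_smul, ih, smul_smul,
        ← pow_succ']
  have h0 := hpow k
  rw [hk, Matrix.zero_mulVec] at h0
  have : a = 0 := eq_zero_of_pow_eq_zero ((smul_eq_zero.1 h0.symm).resolve_right hv)
  exact hne (by rw [← ha, this, zero_smul])

/-- The stabilizer of an ideal point is Zariski closed. -/
theorem isZariskiClosed_stabilizer (ξ : IdealBoundary) :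
    IsZariskiClosed (MulAction.stabilizer PSL(2, ℂ) ξ : Set PSL(2, ℂ)) := by
  induction ξ using Projectivization.ind with | _ v hv =>
  refine ⟨{(MvPolynomial.X (0, 0) * MvPolynomial.C (v 0) +
    MvPolynomial.X (0, 1) * MvPolynomial.C (v 1)) * MvPolynomial.C (v 1) -
    (MvPolynomial.X (1, 0) * MvPolynomial.C (v 0) +
      MvPolynomial.X (1, 1) * MvPolynomial.C (v 1)) * MvPolynomial.C (v 0)}, fun A => ?_⟩
  rw [SetLike.mem_coe, MulAction.mem_stabilizer_iff, smul_mk_eq_self_iff]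
  simp

/-- A representation that fixes two ideal points is reductive: the Zariski closure of its image fixes
both points, and the identity is the only unipotent element that does. -/
theorem isReductive_of_fixed_pair {Γ : Type*} [Group Γ] {ρ : Γ →* PSL(2, ℂ)} {ξ η : IdealBoundary}
    (hne : ξ ≠ η) (hξ : ∀ γ, ρ γ • ξ = ξ) (hη : ∀ γ, ρ γ • η = η) : IsReductive ρ := by
  have hle : ∀ ζ : IdealBoundary, (∀ γ, ρ γ • ζ = ζ) →
      zariskiClosure ρ.range ≤ MulAction.stabilizer PSL(2, ℂ) ζ := by
    intro ζ hζ
    refine sInf_le ⟨?_, isZariskiClosed_stabilizer ζ⟩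
    rintro _ ⟨γ, rfl⟩
    exact hζ γ
  intro N hN _ hunip
  rw [eq_bot_iff]
  intro n hn
  obtain ⟨A, rfl, hnil⟩ := hunip n hn
  have hAξ := hle ξ hξ (hN hn)
  have hAη := hle η hη (hN hn)
  clear hξ hη
  induction ξ using Projectivization.ind with | _ v hv =>
  induction η using Projectivization.ind with | _ w hw =>
  rw [MulAction.mem_stabilizer_iff, smul_mk_eq_self_iff] at hAξ hAη
  have hMv : (A.1 - 1) *ᵥ v = 0 := by
    refine mulVec_eq_zero_of_isNilpotent hnil hv ?_
    simp [Matrix.mulVec, dotProduct]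
    linear_combination hAξ
  have hMw : (A.1 - 1) *ᵥ w = 0 := by
    refine mulVec_eq_zero_of_isNilpotent hnil hw ?_
    simp [Matrix.mulVec, dotProduct]
    linear_combination hAη
  have hdet : v 0 * w 1 - v 1 * w 0 ≠ 0 := fun h => hne ((mk_eq_mk_iff_det hv hw).2 h)
  have hzero : A.1 - 1 = 0 := by
    have hrow : ∀ i, (A.1 - 1) i 0 = 0 ∧ (A.1 - 1) i 1 = 0 := by
      intro i
      have h1 := congrFun hMv i
      have h2 := congrFun hMw i
      simp only [Matrix.mulVec, dotProduct, Fin.sum_univ_two, Pi.zero_apply] at h1 h2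
      constructor
      · refine (mul_eq_zero.1 ?_).resolve_right hdet
        linear_combination w 1 * h1 - v 1 * h2
      · refine (mul_eq_zero.1 ?_).resolve_right hdet
        linear_combination v 0 * h2 - w 0 * h1
    ext i j
    fin_cases j
    · exact (hrow i).1
    · exact (hrow i).2
  have hA : A = 1 := Subtype.ext (sub_eq_zero.1 hzero)
  rw [hA]
  exact Subgroup.one_mem ⊥

theorem exists_of_mul_add_mul_eq_zero {a b x y : ℂ} (h : a * x + b * y = 0)
    (hxy : x ≠ 0 ∨ y ≠ 0) : ∃ c, a = -c * y ∧ b = c * x := by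
  rcases hxy with hx | hy
  · refine ⟨b / x, ?_, by field_simp⟩
    field_simp
    linear_combination h
  · refine ⟨-a / y, by field_simp, ?_⟩
    field_simp
    linear_combination h

/-- If a nilpotent matrix `M` and its conjugate by `B` satisfy `tr (M (B M B⁻¹)) = 0`, then `B` preserves
the kernel of `M`. -/
theorem smul_mk_eq_self_of_trace {M : Matrix (Fin 2) (Fin 2) ℂ} (hM : IsNilpotent M) (hM0 : M ≠ 0)
    {v : Fin 2 → ℂ} (hv : v ≠ 0) (hMv : M *ᵥ v = 0) (B : SL(2, ℂ))
    (h : (M * (B.1 * M * (B⁻¹).1)).trace = 0) :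
    (B : PSL(2, ℂ)) • Projectivization.mk ℂ v hv = Projectivization.mk ℂ v hv := by
  have hv' : v 0 ≠ 0 ∨ v 1 ≠ 0 := by
    by_contra hcon
    push Not at hcon
    exact hv (by ext i; fin_cases i <;> simp [hcon.1, hcon.2])
  have h0 := congrFun hMv 0
  have h1 := congrFun hMv 1
  simp only [Matrix.mulVec, dotProduct, Fin.sum_univ_two, Pi.zero_apply] at h0 h1
  obtain ⟨α, h00, h01⟩ := exists_of_mul_add_mul_eq_zero h0 hv'
  obtain ⟨β, h10, h11⟩ := exists_of_mul_add_mul_eq_zero h1 hv'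
  have ht := trace_eq_zero_of_isNilpotent hM
  rw [Matrix.trace_fin_two, h00, h11] at ht
  obtain ⟨c, hβ, hα⟩ := exists_of_mul_add_mul_eq_zero (a := β) (b := -α) (x := v 0) (y := v 1)
    (by linear_combination ht) hv'
  -- `M = c v (Jv)ᵀ` with the rotation `J v = (v₁, -v₀)`
  have hα' : α = -c * v 0 := by linear_combination -hα
  have hc : c ≠ 0 := by
    rintro rfl
    refine hM0 ?_
    ext i j
    fin_cases i <;> fin_cases j <;> simp [h00, h01, h10, h11, hα', hβ]
  have hdet : B.1 0 0 * B.1 1 1 - B.1 0 1 * B.1 1 0 = 1 := by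
    rw [← Matrix.det_fin_two, B.2]
  rw [smul_mk_eq_self_iff]
  rw [Matrix.SpecialLinearGroup.coe_inv, Matrix.adjugate_fin_two, Matrix.trace_fin_two] at h
  simp only [Matrix.mul_apply, Fin.sum_univ_two, h00, h01, h10, h11, hα', hβ, Matrix.of_apply,
    Matrix.cons_val', Matrix.cons_val_zero, Matrix.cons_val_one, Matrix.cons_val_fin_one] at h
  have hsq : c ^ 2 * ((B.1 0 0 * v 0 + B.1 0 1 * v 1) * v 1 -
      (B.1 1 0 * v 0 + B.1 1 1 * v 1) * v 0) ^ 2 = 0 := by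
    linear_combination -h
  simpa [hc] using hsq

/-- A representation that is not reductive fixes an ideal point: the conjugates of an element of the
unipotent radical by elements of the group have the same fixed point. -/
theorem exists_fixed_of_not_isReductive {Γ : Type*} [Group Γ] {ρ : Γ →* PSL(2, ℂ)}
    (h : ¬ IsReductive ρ) : ∃ ξ : IdealBoundary, ∀ γ, ρ γ • ξ = ξ := by
  simp only [IsReductive, IsReductiveSubgroup, not_forall] at h
  obtain ⟨N, hN, hnorm, hunip, hbot⟩ := h
  obtain ⟨⟨n, hn⟩, hn'⟩ := N.ne_bot_iff_exists_ne_one.1 hbot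
  have hn1 : n ≠ 1 := fun h => hn' (Subtype.ext h)
  obtain ⟨A, hA, hnil⟩ := hunip n hn
  set M : Matrix (Fin 2) (Fin 2) ℂ := A.1 - 1 with hMdef
  have hAM : A.1 = 1 + M := by rw [hMdef]; abel
  have hM0 : M ≠ 0 := by
    intro h0
    refine hn1 ?_
    have : A = 1 := Subtype.ext (sub_eq_zero.1 h0)
    rw [← hA, this]
    rfl
  have hMdet := det_eq_zero_of_isNilpotent hnil
  have hMtr : M.trace = 0 := trace_eq_zero_of_isNilpotent hnil
  obtain ⟨v, hv, hMv⟩ := Matrix.exists_mulVec_eq_zero_iff.2 hMdet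
  refine ⟨Projectivization.mk ℂ v hv, fun γ => ?_⟩
  obtain ⟨B, hB⟩ := QuotientGroup.mk_surjective (ρ γ)
  rw [← hB]
  refine smul_mk_eq_self_of_trace hnil hM0 hv hMv B ?_
  set M' := B.1 * M * (B⁻¹).1 with hM'
  have hBB : B.1 * (B⁻¹).1 = 1 := by
    rw [← Matrix.SpecialLinearGroup.coe_mul, mul_inv_cancel, Matrix.SpecialLinearGroup.coe_one]
  have hBB' : (B⁻¹).1 * B.1 = 1 := by
    rw [← Matrix.SpecialLinearGroup.coe_mul, inv_mul_cancel, Matrix.SpecialLinearGroup.coe_one]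
  have hconj : (B * A * B⁻¹).1 = 1 + M' := by
    rw [Matrix.SpecialLinearGroup.coe_mul, Matrix.SpecialLinearGroup.coe_mul, hAM, mul_add, add_mul,
      mul_one, hBB]
  have htr' : M'.trace = 0 := by
    rw [hM', Matrix.trace_mul_comm, ← mul_assoc, hBB', one_mul, hMtr]
  have hMM : M * M = 0 := by
    have hm : M 0 0 + M 1 1 = 0 := by rw [← Matrix.trace_fin_two, hMtr]
    have hd : M 0 0 * M 1 1 - M 0 1 * M 1 0 = 0 := by rw [← Matrix.det_fin_two, hMdet]
    ext i j
    fin_cases i <;> fin_cases j <;> simp [Matrix.mul_apply]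
    · linear_combination M 0 0 * hm - hd
    · linear_combination M 0 1 * hm
    · linear_combination M 1 0 * hm
    · linear_combination M 1 1 * hm - hd
  have hmem : (B : PSL(2, ℂ)) * A * (B : PSL(2, ℂ))⁻¹ ∈ N := by
    refine hnorm _ ?_ _ (hA ▸ hn)
    rw [hB]
    exact Subgroup.mem_sInf.2 fun G hG => hG.1 ⟨γ, rfl⟩
  have hA' : (A : PSL(2, ℂ)) ∈ N := hA ▸ hn
  -- the traces of the unipotent elements `n n'` and `n² n'`, for the conjugate `n'` of `n`
  have u1 := trace_of_isUnipotent (A := A * (B * A * B⁻¹)) (hunip _ (N.mul_mem hA' hmem))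
  have u2 := trace_of_isUnipotent (A := A * (A * (B * A * B⁻¹)))
    (hunip _ (N.mul_mem hA' (N.mul_mem hA' hmem)))
  have e1 : (A * (B * A * B⁻¹)).1.trace = 2 + (M * M').trace := by
    rw [Matrix.SpecialLinearGroup.coe_mul, hconj, hAM]
    simp only [add_mul, mul_add, one_mul, mul_one, Matrix.trace_add, hMtr, htr', Matrix.trace_one,
      Fintype.card_fin]
    push_cast
    ring
  have e2 : (A * (A * (B * A * B⁻¹))).1.trace = 2 + 2 * (M * M').trace := by
    rw [Matrix.SpecialLinearGroup.coe_mul, Matrix.SpecialLinearGroup.coe_mul, hconj, hAM]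
    simp only [add_mul, mul_add, one_mul, mul_one, Matrix.trace_add, hMtr, htr', Matrix.trace_one,
      Fintype.card_fin, ← mul_assoc, hMM, zero_mul, Matrix.trace_zero]
    push_cast
    ring
  rw [e1] at u1
  rw [e2] at u2
  rcases u1 with u1 | u1
  · linear_combination u1
  · rcases u2 with u2 | u2
    · linear_combination u2 / 2
    · exfalso
      have : (2 : ℂ) = 0 := by linear_combination u1 - u2 / 2
      norm_num at this

/-! ### Critical maps and the fixed points of the representation -/

variable {Γ : Type*} [Group Γ] [MulAction Γ ℍ] {D : Set ℍ} {ρ : Γ →* PSL(2, ℂ)}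

/-- If the representation fixes the ideal point `ξ`, then a critical map takes values in a geodesic
ending in `ξ`, and the other end of this geodesic is fixed, too. -/
theorem IsCritical.exists_fixed_and_finrank_le (hΓ : IsClosedSurfaceGroup Γ)
    (hD : IsFundamentalDomain Γ D (volume : Measure ℍ)) (hf : IsSmooth f)
    (he : IsEquivariant ρ f) (hcrit : IsCritical D ρ f) {ξ : IdealBoundary}
    (hξ : ∀ γ, ρ γ • ξ = ξ) :
    (∃ η, ξ ≠ η ∧ ∀ γ, ρ γ • η = η) ∧
      ∀ p, Module.finrank ℝ (LinearMap.range (differential f p)) ≤ 1 := by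
  have he0 : (![1, 0] : Fin 2 → ℂ) ≠ 0 := fun h => by simpa using congrFun h 0
  obtain ⟨B, hBξ⟩ := MulAction.exists_smul_eq SL(2, ℂ) (Projectivization.mk ℂ ![1, 0] he0) ξ
  have hBξ' : (B : PSL(2, ℂ)) • Projectivization.mk ℂ ![1, 0] he0 = ξ := hBξ
  have hupper : ∀ γ (A : SL(2, ℂ)), (A : PSL(2, ℂ)) = ρ γ → (B⁻¹ * A * B).1 1 0 = 0 := by
    intro γ A hA
    have h1 : ((B⁻¹ * A * B : SL(2, ℂ)) : PSL(2, ℂ)) • Projectivization.mk ℂ ![1, 0] he0 =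
        Projectivization.mk ℂ ![1, 0] he0 := by
      rw [QuotientGroup.mk_mul, QuotientGroup.mk_mul, QuotientGroup.mk_inv, mul_smul, mul_smul,
        hBξ', hA, hξ, ← hBξ', inv_smul_smul]
    rw [smul_mk_eq_self_iff] at h1
    simpa using h1
  have hH := hcrit.horizontal_eq_zero hΓ hD hf he B hupper
  refine ⟨?_, fun p => finrank_range_differential_le_one hf B p (hH p)⟩
  obtain ⟨z₀, hz⟩ := exists_eq_mul_of_horizontal_eq_zero (hf.smul B⁻¹) hH
  have hz0 : (![z₀, 1] : Fin 2 → ℂ) ≠ 0 := fun h => by simpa using congrFun h 1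
  refine ⟨(B : PSL(2, ℂ)) • Projectivization.mk ℂ ![z₀, 1] hz0, fun h => ?_, fun γ => ?_⟩
  · rw [← hBξ', smul_left_cancel_iff, mk_eq_mk_iff_det] at h
    simp at h
  · obtain ⟨A, hA⟩ := QuotientGroup.mk_surjective (ρ γ)
    have hu := hupper γ A hA
    -- the point `z₀` is fixed by `B⁻¹ A B`, as this map preserves the set `z = z₀`
    have hfix : ((B⁻¹ * A * B : SL(2, ℂ)) : PSL(2, ℂ)) • Projectivization.mk ℂ ![z₀, 1] hz0 =
        Projectivization.mk ℂ ![z₀, 1] hz0 := by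
      set X : H3 := B⁻¹ • f UpperHalfPlane.I with hX
      have h1 : B⁻¹ • f (γ • UpperHalfPlane.I) = (B⁻¹ * A * B) • X := by
        rw [he, ← hA, mk_smul, hX]
        simp only [smul_smul]
        group
      have h2 := hz (γ • UpperHalfPlane.I)
      have h3 := hz UpperHalfPlane.I
      rw [h1, (smul_apply_of_upper hu X).1, (smul_apply_of_upper hu X).2] at h2
      rw [← hX] at h3
      rw [h3, Complex.normSq_eq_conj_mul_self] at h2
      have hdet := det_of_upper hu
      have hne : star ((B⁻¹ * A * B).1 1 1) ≠ 0 := by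
        rw [Ne, star_eq_zero]
        exact right_ne_zero_of_mul_eq_one hdet
      have hX1 : X.1 1 1 ≠ 0 := fun h => by simpa [h] using X.re_pos 1
      rw [smul_mk_eq_self_iff, hu]
      simp only [Matrix.cons_val_zero, Matrix.cons_val_one, zero_mul, mul_one, zero_add]
      refine (mul_eq_zero.1 ?_).resolve_right (mul_ne_zero hne hX1)
      rw [Complex.star_def] at h2 ⊢
      linear_combination h2
    rw [← hA]
    have h4 := congrArg ((B : PSL(2, ℂ)) • ·) hfix
    simp only [QuotientGroup.mk_mul, QuotientGroup.mk_inv, mul_smul, smul_inv_smul] at h4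
    exact h4

end SchattenEnergy

theorem mainTheorem9 {Γ : Type*} [Group Γ] [MulAction Γ ℍ]
    (hΓ : SchattenEnergy.IsClosedSurfaceGroup Γ)
    (D : Set ℍ) (hD : IsFundamentalDomain Γ D (volume : Measure ℍ))
    (ρ : Γ →* PSL(2, ℂ)) :
    ((∃ f : ℍ → SchattenEnergy.H3, SchattenEnergy.IsSmooth f ∧ SchattenEnergy.IsEquivariant ρ f ∧
        SchattenEnergy.IsCritical D ρ f) →
      SchattenEnergy.IsReductive ρ) ∧
    ((∃ f : ℍ → SchattenEnergy.H3, SchattenEnergy.IsSmooth f ∧ SchattenEnergy.IsEquivariant ρ f ∧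
        SchattenEnergy.IsCritical D ρ f ∧
        ∃ p : ℍ, Module.finrank ℝ (LinearMap.range (SchattenEnergy.differential f p)) = 2) →
      SchattenEnergy.IsNonElementary ρ) := by
  constructor
  · rintro ⟨f, hf, he, hcrit⟩
    by_contra hred
    obtain ⟨ξ, hξ⟩ := SchattenEnergy.exists_fixed_of_not_isReductive hred
    obtain ⟨⟨η, hne, hη⟩, -⟩ := hcrit.exists_fixed_and_finrank_le hΓ hD hf he hξ
    exact hred (SchattenEnergy.isReductive_of_fixed_pair hne hξ hη)
  · rintro ⟨f, hf, he, hcrit, p, hp⟩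
    constructor
    · rintro ⟨x, hx⟩
      have h0 : SchattenEnergy.differential f p = 0 :=
        LinearMap.ext fun v => hcrit.differential_eq_zero hΓ hD hf he hx p v
      rw [h0, LinearMap.range_zero, finrank_bot] at hp
      exact absurd hp (by norm_num)
    · rintro ⟨ξ, hξ⟩
      have := (hcrit.exists_fixed_and_finrank_le hΓ hD hf he hξ).2 p
      omega
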